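/- **Setting.** Let $\Omega\subset\mathbb R^2$ be a bounded polygonal domain with Lipschitz boundary and $\Gamma^D\subset\partial\Omega$ relatively open. Let $\mathcal T_h$ be a conforming triangulation exactly fitting $\Omega$, with subdivision parameter $h>0$, which is shape regular and quasi-uniform with constant $\sigma$: every $T\in\mathcal T_h$ has diameter $h_T\le h\le\sigma h_T$ and contains a disc of diameter at least $h_T/\sigma$. Let $\mathcal E_h^i$ be the set of internal edges and $\mathcal E_h^b$ the set of boundary edges lying (up to endpoints) in $\Gamma^D$, and assume $\mathcal E_h^b\ne\emptyset$. Let $\Gamma_h$ and $\Gamma_h^b$ be the unions of the edges in $\mathcal E_h^i\cup\mathcal E_h^b$ and in $\mathcal E_h^b$, let $n$ be a unit normal on each of these edges (outward on $\mathcal E_h^b$), and let $x_T$ be the barycenter of $T$. On an internal edge, $q^\mp$ are the traces from the side that $n$ points away from / into; put $[y]=y^--y^+$, $[\nabla_h y]=(\nabla_h y^--\nabla_h y^+)n$ and $\{q\}=\frac12(q^-+q^+)$; on an edge of $\mathcal E_h^b$ put $[y]=y$, $[\nabla_h y]=(\nabla_h y)n$, $\{q\}=q$. Here $\nabla_h,\nabla_h^2$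 are the elementwise gradient and Hessian. Let $V_h=\mathbb P^2(\mathcal T_h)^3$, $M_h=\mathbb P^0(\mathcal T_h)^{3\times2}$, let $\Upsilon_h$ be the space of piecewise constant symmetric $2\times2$ matrices, $St(3,2)=\{U\in\mathbb R^{3\times2}: U^\top U=I\}$ and $$\mathbb A_h=\{y\in V_h:\ \nabla_h y(x_T)\in St(3,2)\ \ \forall T\in\mathcal T_h\},\qquad \operatorname{Exp}_U(W)=\exp(WU^\top-UW^\top)\,U\exp(-U^\top W).$$ For $f\in L^2(\Omega)^3$, $y_D,G_D\in L^2(\Gamma^D)^3$ and $\eta_0,\eta_1>0$ let $$\begin{aligned}a_h(y,w)={}&\int_\Omega\nabla_h^2y:\nabla_h^2w\,dx-\int_{\Gamma_h}[\nabla_h y]\cdot(\{\nabla_h^2w\}n)n\,dS-\int_{\Gamma_h}[\nabla_h w]\cdot(\{\nabla_h^2y\}n)n\,dS\\&+\eta_1\int_{\Gamma_h}h^{-1}[\nabla_h y]\cdot[\nabla_h w]\,dS+\eta_0\int_{\Gamma_h}h^{-3}[y]\cdot[w]\,dS,\end{aligned}$$ $$F_h(w)=-\int_{\Gamma_h^b}G_D\cdot(\{\nabla_h^2w\}n)n\,dS+\eta_1\int_{\Gamma_h^b}h^{-1}G_D\cdot(\nabla_h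 w)n\,dS+\eta_0\int_{\Gamma_h^b}h^{-3}y_D\cdot w\,dS,$$ $E_h(y)=\frac12a_h(y,y)-(f,y)-F_h(y)$, and $l_h(G;m,\gamma)=\sum_T\int_T\gamma:(G^\top m+m^\top G)(x_T)\,dx$, where $(\cdot,\cdot)$ is the $L^2(\Omega)$ inner product. Given $y_h^k\in\mathbb A_h$ and $\tau>0$, a solution of the discrete proximal system is a triple $(y_h^{k+1},\mu_h^{k+1},\gamma_h^{k+1})\in\mathbb A_h\times M_h\times\Upsilon_h$ such that, for all $w_h\in V_h$, $v_h\in M_h$, $\zeta_h\in\Upsilon_h$, $$\begin{aligned}a_h(y_h^{k+1},w_h)+(\mu_h^{k+1},\nabla_hw_h)+l_h(\nabla_hy_h^k;\nabla_hw_h,\gamma_h^{k+1})&=(f,w_h)+F_h(w_h),\\(\nabla_hy_h^{k+1},v_h)-\sum_{T}\big(\operatorname{Exp}_{\nabla_hy_h^k(x_T)}(\tau\mu_h^{k+1}),v_h\big)_{L^2(T)}&=0,\\l_h(\nabla_hy_h^k;\mu_h^{k+1},\zeta_h)&=0.\end{aligned}$$ **Proposition (discrete energy dissipation).** For every $\sigma$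 there is $\eta_{\min}>0$, depending only on $\sigma$, such that in the above setting, for all $\eta_0>0$ and $\eta_1\ge\eta_{\min}$, there is $\tau_0>0$ (independent of $y_h^k$) with the following property. For all $0<\tau<\tau_0$, all $y_h^k\in\mathbb A_h$ and every corresponding solution $(y_h^{k+1},\mu_h^{k+1},\gamma_h^{k+1})$ of the discrete proximal system with $y_h^{k+1}\ne y_h^k$, $$E_h(y_h^{k+1})<E_h(y_h^k).$$ -/

import Mathlib

open scoped Matrix

namespace PlateIPDG

noncomputable section

/-- The plane containing the reference domain. -/
abbrev Plane := EuclideanSpace ℝ (Fin 2)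

/-! ### The Stiefel manifold `St(3,2)` -/

/-- `St(3,2)`. -/
def Stiefel : Set (Matrix (Fin 3) (Fin 2) ℝ) := {U | Uᵀ * U = 1}

/-- The exponential map of `St(3,2)` for the Euclidean metric,
`Exp_U(W) = exp(W Uᵀ - U Wᵀ) U exp(-Uᵀ W)`, extended by the same formula to all `3 × 2`
matrices `W`; `exp` is the matrix exponential. -/
def stiefelExp (U W : Matrix (Fin 3) (Fin 2) ℝ) : Matrix (Fin 3) (Fin 2) ℝ :=
  NormedSpace.exp (W * Uᵀ - U * Wᵀ) * U * NormedSpace.exp (-(Uᵀ * W))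

/-- The Frobenius product `A : B` of two matrices. -/
def frob {m n : Type*} [Fintype m] [Fintype n] (A B : Matrix m n ℝ) : ℝ :=
  ∑ i, ∑ j, A i j * B i j

/-! ### Triangulations -/

/-- A (conforming) triangulation exactly fitting `Ω`: a finite simplicial complex in the plane,
all of whose maximal simplices are triangles, and whose underlying space is the closure of `Ω`.
A simplex is given by the finite set of its vertices; the closed triangle or edge itself is the
convex hull of that set. -/
structure Triangulation (Ω : Set Plane) where
  complex : Geometry.SimplicialComplex ℝ Plane
  finite : complex.faces.Finite
  pure : ∀ s ∈ complex.faces, ∃ t ∈ complex.faces, s ⊆ t ∧ t.card = 3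
  space_eq : complex.space = closure Ω

/-- The arithmetic mean of the vertices of a simplex: the barycenter `x_T` of a triangle,
the midpoint of an edge. -/
def bary (s : Finset Plane) : Plane := (s.card : ℝ)⁻¹ • ∑ v ∈ s, v

/-- The relative interior of an edge with endpoints `e`: the segment without its endpoints. -/
def openEdge (e : Finset Plane) : Set Plane := convexHull ℝ (e : Set Plane) \ (e : Set Plane)

namespace Triangulation

variable {Ω : Set Plane} (𝒯 : Triangulation Ω)

/-- The triangles of the mesh. -/
def cells : Finset (Finset Plane) := 𝒯.finite.toFinset.filter fun s => s.card = 3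

/-- All edges of the mesh. -/
def edges : Finset (Finset Plane) := 𝒯.finite.toFinset.filter fun s => s.card = 2

/-- The type of triangles `T ∈ 𝒯`. -/
abbrev Cell := {T : Finset Plane // T ∈ 𝒯.cells}

open Classical in
/-- The internal edges. -/
def interiorEdges : Finset (Finset Plane) := 𝒯.edges.filter fun e => openEdge e ⊆ Ω

open Classical in
/-- The active boundary edges: the edges which (up to their endpoints) lie in `ΓD`. -/
def boundaryEdges (ΓD : Set Plane) : Finset (Finset Plane) :=
  𝒯.edges.filter fun e => openEdge e ⊆ ΓD

/-- Shape regularity and quasi-uniformity with constant `σ` of a mesh with subdivision parameter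
`h`: every triangle `T` has diameter `h_T ≤ h ≤ σ h_T`, and contains a disc whose diameter `2 r`
satisfies `h_T ≤ σ (2 r)`. -/
def IsRegular (h σ : ℝ) : Prop :=
  ∀ T ∈ 𝒯.cells,
    Metric.diam (convexHull ℝ (T : Set Plane)) ≤ h ∧
    h ≤ σ * Metric.diam (convexHull ℝ (T : Set Plane)) ∧
    ∃ (c : Plane) (r : ℝ), 0 < r ∧ Metric.closedBall c r ⊆ convexHull ℝ (T : Set Plane) ∧
      Metric.diam (convexHull ℝ (T : Set Plane)) ≤ σ * (2 * r)

/-- `n e` is a unit normal to each active edge `e`: one of the two (arbitrarily chosen) for an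
internal edge, and the one pointing out of the adjacent triangle for a boundary edge in `ΓD`. -/
def IsNormalField (ΓD : Set Plane) (n : Finset Plane → Plane) : Prop :=
  (∀ e ∈ 𝒯.interiorEdges ∪ 𝒯.boundaryEdges ΓD,
    ‖n e‖ = 1 ∧ ∀ a ∈ e, ∀ b ∈ e, inner ℝ (n e) (b - a) = 0) ∧
  ∀ e ∈ 𝒯.boundaryEdges ΓD, ∀ T ∈ 𝒯.cells, e ⊆ T → inner ℝ (n e) (bary T - bary e) < 0

/-! ### Discrete spaces -/

/-- `V_h = ℙ²(𝒯)³`: on each triangle, three polynomials of total degree at most `2`. -/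
abbrev Vh := 𝒯.Cell → Fin 3 → MvPolynomial.restrictTotalDegree (Fin 2) ℝ 2

/-- `M_h = ℙ⁰(𝒯)^{3×2}`. -/
abbrev Mh := 𝒯.Cell → Matrix (Fin 3) (Fin 2) ℝ

/-- `Υ_h`: piecewise constant symmetric `2 × 2` matrices. -/
abbrev Upsh := 𝒯.Cell → {γ : Matrix (Fin 2) (Fin 2) ℝ // γᵀ = γ}

variable {𝒯}

/-- The value at `x` of the polynomial that `y` is on `T`. -/
def val (y : 𝒯.Vh) (T : 𝒯.Cell) (x : Plane) : Fin 3 → ℝ := fun i =>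
  MvPolynomial.eval (fun j => x j) (y T i : MvPolynomial (Fin 2) ℝ)

/-- The broken gradient `(∇_h y)_{ij} = ∂_j y_i`, on `T` at `x`. -/
def grad (y : 𝒯.Vh) (T : 𝒯.Cell) (x : Plane) : Matrix (Fin 3) (Fin 2) ℝ := Matrix.of fun i j =>
  MvPolynomial.eval (fun l => x l) (MvPolynomial.pderiv j (y T i : MvPolynomial (Fin 2) ℝ))

/-- The broken Hessian `(∇²_h y)_i = (∂_k ∂_j y_i)_{jk}`, on `T` at `x`. -/
def hess (y : 𝒯.Vh) (T : 𝒯.Cell) (x : Plane) : Fin 3 → Matrix (Fin 2) (Fin 2) ℝ := fun i =>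
  Matrix.of fun j k => MvPolynomial.eval (fun l => x l)
    (MvPolynomial.pderiv k (MvPolynomial.pderiv j (y T i : MvPolynomial (Fin 2) ℝ)))

variable (𝒯)

/-- The discrete admissible set `𝔸_h`. -/
def admissible : Set 𝒯.Vh := {y | ∀ T : 𝒯.Cell, grad y T (bary T.1) ∈ Stiefel}

/-! ### Integrals, traces, jumps and averages -/

/-- Integral over the triangulated domain of a function given triangle by triangle. -/
def cellIntegral (g : 𝒯.Cell → Plane → ℝ) : ℝ :=
  ∑ T : 𝒯.Cell, ∫ x in convexHull ℝ (T.1 : Set Plane), g T x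

/-- Integral, with respect to arc length, over a union of edges of a function given edge by
edge. -/
def edgeIntegral (E : Finset (Finset Plane)) (g : Finset Plane → Plane → ℝ) : ℝ :=
  ∑ e ∈ E, ∫ x in convexHull ℝ (e : Set Plane), g e x ∂(MeasureTheory.Measure.hausdorffMeasure 1)

open Classical in
/-- The trace `q⁻` on the edge `e` of a piecewise quantity `q`, i.e. its value in the triangle
adjacent to `e` which lies on the side of `e` that `n e` points away from. The sum has exactly
one term, for internal edges and for boundary edges with outward normal. -/
def traceMinus {A : Type*} [AddCommMonoid A] (n : Finset Plane → Plane) (e : Finset Plane)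
    (q : 𝒯.Cell → A) : A :=
  ∑ T : 𝒯.Cell with e ⊆ T.1 ∧ inner ℝ (n e) (bary T.1 - bary e) < 0, q T

open Classical in
/-- The trace `q⁺` on the edge `e` of a piecewise quantity `q`, i.e. its value in the triangle
adjacent to `e` which lies on the side of `e` that `n e` points to. The sum has exactly
one term for internal edges, and is `0` for boundary edges with outward normal. -/
def tracePlus {A : Type*} [AddCommMonoid A] (n : Finset Plane → Plane) (e : Finset Plane)
    (q : 𝒯.Cell → A) : A :=
  ∑ T : 𝒯.Cell with e ⊆ T.1 ∧ 0 < inner ℝ (n e) (bary T.1 - bary e), q T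

/-- The jump `q⁻ - q⁺`; on a boundary edge (with outward normal) this is the trace of `q`. -/
def jump {A : Type*} [AddCommGroup A] (n : Finset Plane → Plane) (e : Finset Plane)
    (q : 𝒯.Cell → A) : A :=
  𝒯.traceMinus n e q - 𝒯.tracePlus n e q

open Classical in
/-- The average: `(q⁻ + q⁺) / 2` on an internal edge, and the trace of `q` on a boundary edge. -/
def average {A : Type*} [AddCommGroup A] [Module ℝ A] (n : Finset Plane → Plane)
    (e : Finset Plane) (q : 𝒯.Cell → A) : A :=
  if e ∈ 𝒯.interiorEdges then (2⁻¹ : ℝ) • (𝒯.traceMinus n e q + 𝒯.tracePlus n e q)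
  else 𝒯.traceMinus n e q

variable {𝒯}

/-- `[y]_e` at `x ∈ e`. -/
def jumpVal (n : Finset Plane → Plane) (y : 𝒯.Vh) (e : Finset Plane) (x : Plane) : Fin 3 → ℝ :=
  𝒯.jump n e fun T => val y T x

/-- `[∇_h y]_e = (∇_h y⁻ - ∇_h y⁺) n_e` at `x ∈ e` (`(∇_h y) n_e` on a boundary edge). -/
def jumpGrad (n : Finset Plane → Plane) (y : 𝒯.Vh) (e : Finset Plane) (x : Plane) : Fin 3 → ℝ :=
  (𝒯.jump n e fun T => grad y T x) *ᵥ (n e).ofLp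

/-- `({∇²_h y} n_e) n_e` at `x ∈ e`. -/
def avgHess (n : Finset Plane → Plane) (y : 𝒯.Vh) (e : Finset Plane) (x : Plane) : Fin 3 → ℝ :=
  fun i => ((𝒯.average n e fun T => hess y T x) i *ᵥ (n e).ofLp) ⬝ᵥ (n e).ofLp

/-! ### Discrete forms and energy -/

/-- The symmetric interior penalty form `a_h(y, w)`. -/
def ah (ΓD : Set Plane) (n : Finset Plane → Plane) (h η₀ η₁ : ℝ) (y w : 𝒯.Vh) : ℝ :=
  𝒯.cellIntegral (fun T x => ∑ i, frob (hess y T x i) (hess w T x i))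
  - edgeIntegral (𝒯.interiorEdges ∪ 𝒯.boundaryEdges ΓD)
      (fun e x => jumpGrad n y e x ⬝ᵥ avgHess n w e x)
  - edgeIntegral (𝒯.interiorEdges ∪ 𝒯.boundaryEdges ΓD)
      (fun e x => jumpGrad n w e x ⬝ᵥ avgHess n y e x)
  + η₁ * edgeIntegral (𝒯.interiorEdges ∪ 𝒯.boundaryEdges ΓD)
      (fun e x => h⁻¹ * (jumpGrad n y e x ⬝ᵥ jumpGrad n w e x))
  + η₀ * edgeIntegral (𝒯.interiorEdges ∪ 𝒯.boundaryEdges ΓD)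
      (fun e x => (h ^ 3)⁻¹ * (jumpVal n y e x ⬝ᵥ jumpVal n w e x))

/-- The linear form `F_h(w)` carrying the boundary data `yD` and `GD`. -/
def Fh (ΓD : Set Plane) (n : Finset Plane → Plane) (h η₀ η₁ : ℝ) (yD GD : Plane → Fin 3 → ℝ)
    (w : 𝒯.Vh) : ℝ :=
  - edgeIntegral (𝒯.boundaryEdges ΓD) (fun e x => GD x ⬝ᵥ avgHess n w e x)
  + η₁ * edgeIntegral (𝒯.boundaryEdges ΓD) (fun e x => h⁻¹ * (GD x ⬝ᵥ jumpGrad n w e x))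
  + η₀ * edgeIntegral (𝒯.boundaryEdges ΓD) (fun e x => (h ^ 3)⁻¹ * (yD x ⬝ᵥ jumpVal n w e x))

/-- The `L²` product `(f, w)`. -/
def load (f : Plane → Fin 3 → ℝ) (w : 𝒯.Vh) : ℝ :=
  𝒯.cellIntegral fun T x => f x ⬝ᵥ val w T x

/-- The discrete energy `E_h(y) = a_h(y, y) / 2 - (f, y) - F_h(y)`. -/
def Eh (ΓD : Set Plane) (n : Finset Plane → Plane) (h η₀ η₁ : ℝ) (f yD GD : Plane → Fin 3 → ℝ)
    (y : 𝒯.Vh) : ℝ :=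
  1 / 2 * ah ΓD n h η₀ η₁ y y - load f y - Fh ΓD n h η₀ η₁ yD GD y

/-- The `L²` product of two piecewise defined `3 × 2` matrix fields. -/
def matInner (P Q : 𝒯.Cell → Plane → Matrix (Fin 3) (Fin 2) ℝ) : ℝ :=
  𝒯.cellIntegral fun T x => frob (P T x) (Q T x)

/-- The trilinear form `l_h(G; m, γ) = ∑_T ∫_T γ : (Gᵀ m + mᵀ G)(x_T) dx`. -/
def lh (G m : 𝒯.Cell → Plane → Matrix (Fin 3) (Fin 2) ℝ) (γ : 𝒯.Upsh) : ℝ :=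
  𝒯.cellIntegral fun T _ => frob (γ T).1
    ((G T (bary T.1))ᵀ * m T (bary T.1) + (m T (bary T.1))ᵀ * G T (bary T.1))

/-- `(y', μ, γ) ∈ 𝔸_h × M_h × Υ_h` solves the discrete proximal system with step `τ` and
previous iterate `y`. -/
structure IsProximalStep (ΓD : Set Plane) (n : Finset Plane → Plane) (h η₀ η₁ : ℝ)
    (f yD GD : Plane → Fin 3 → ℝ) (τ : ℝ) (y y' : 𝒯.Vh) (μ : 𝒯.Mh) (γ : 𝒯.Upsh) : Prop where
  mem_admissible : y' ∈ 𝒯.admissible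
  momentum : ∀ w : 𝒯.Vh,
    ah ΓD n h η₀ η₁ y' w + matInner (fun T _ => μ T) (grad w) + lh (grad y) (grad w) γ
      = load f w + Fh ΓD n h η₀ η₁ yD GD w
  update : ∀ v : 𝒯.Mh,
    matInner (grad y') (fun T _ => v T)
      - matInner (fun T _ => stiefelExp (grad y T (bary T.1)) (τ • μ T)) (fun T _ => v T) = 0
  tangent : ∀ ζ : 𝒯.Upsh, lh (grad y) (fun T _ => μ T) ζ = 0

end Triangulation

end

end PlateIPDG

/-!
The energy `E_h` is quadratic, so with `d = y' - y` and the momentum equation tested with `d`,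
`E_h(y') - E_h(y) = -a_h(d, d) / 2 - (μ, ∇_h d) - l_h(∇_h y; ∇_h d, γ)`. The theorem follows from
positive definiteness of `a_h` (`ah_self_pos`) and nonnegativity of
`(μ, ∇_h d) + l_h(∇_h y; ∇_h d, γ)` for small `τ`, uniformly in `y`.

*Positive definiteness.* Hessians are piecewise constant, there is at most one triangle on each side
of an edge (`cell_eq_of_same_side`), and `h²` is at most a multiple, depending on `σ` only, of the
area of each triangle. So Young's inequality absorbs the consistency terms into half of the Hessian
term and part of the `η₁` penalty (`consistency_le`). If `a_h(y, y) ≤ 0`, then `y` is piecewise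
affine and its jumps vanish. Hence `y` vanishes on a triangle at an active boundary edge, and this
spreads across internal edges to the whole mesh: `Ω` without the vertices of the mesh is connected,
and triangles meet away from vertices only in internal edges (`cell_induction`).

*Multiplier terms.* Broken gradients are affine on each triangle and the barycenter rule is exact
for affine functions (`setIntegral_affine`), so everything reduces to the values
`U = ∇_h y(x_T)` and `D = ∇_h d(x_T)`. As `U` and `U + D` lie in `St(3,2)`,
`Uᵀ D + Dᵀ U = -Dᵀ D`; as `μ` is tangent, `D = τ μ + O(τ² |μ|²)`
(`exists_norm_stiefelExp_sub_le`). The terms are therefore at least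
`τ |μ|² - C τ² (|μ| + |γ|) |μ|²` on each triangle, which is nonnegative for small `τ` once `μ` and
`γ` are bounded independently of `y`. Such bounds (`exists_multiplier_bound`) hold although `y` is
arbitrary: testing with a lift of `μ + U γ` controls `μ` and `γ` by `y'`, and testing with `y'`
controls `y'`, since the gradients at the barycenters are bounded by the constraint. Here `τ₀` may
depend on the mesh, so all norms on the discrete spaces are equivalent, and this part is carried out
in a finite-dimensional inner product space with inner product `a_h` (`exists_step_energy_lt`).
-/

namespace PlateIPDG

noncomputable section

open Triangulation

/-! ### Piecewise quadratic functions -/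

/-- A polynomial of total degree at most two in two variables is determined by six coefficients. -/
theorem exists_quadratic_coeffs {p : MvPolynomial (Fin 2) ℝ}
    (hp : p ∈ MvPolynomial.restrictTotalDegree (Fin 2) ℝ 2) :
    ∃ a b₀ b₁ c₀ c₁ c₂ : ℝ, p = .C a + .C b₀ * .X 0 + .C b₁ * .X 1 + .C c₀ * (.X 0 * .X 0)
      + .C c₁ * (.X 0 * .X 1) + .C c₂ * (.X 1 * .X 1) := by
  have hmon : ∀ s : Fin 2 →₀ ℕ, (s.sum fun _ e => e) ≤ 2 → ∀ r : ℝ,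
      ∃ a b₀ b₁ c₀ c₁ c₂ : ℝ, MvPolynomial.monomial s r = .C a + .C b₀ * .X 0 + .C b₁ * .X 1
        + .C c₀ * (.X 0 * .X 0) + .C c₁ * (.X 0 * .X 1) + .C c₂ * (.X 1 * .X 1) := by
    intro s hs r
    rw [Finsupp.sum_fintype _ _ (fun _ => rfl), Fin.sum_univ_two] at hs
    have hm : MvPolynomial.monomial s r
        = .C r * (MvPolynomial.X 0 ^ s 0 * MvPolynomial.X 1 ^ s 1) := by
      rw [MvPolynomial.monomial_eq, Finsupp.prod_fintype _ _ (fun _ => pow_zero _),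
        Fin.prod_univ_two]
    rw [hm]
    obtain h | h | h | h | h | h : (s 0 = 0 ∧ s 1 = 0) ∨ (s 0 = 1 ∧ s 1 = 0) ∨
        (s 0 = 0 ∧ s 1 = 1) ∨ (s 0 = 2 ∧ s 1 = 0) ∨ (s 0 = 1 ∧ s 1 = 1) ∨
        (s 0 = 0 ∧ s 1 = 2) := by omega
    · exact ⟨r, 0, 0, 0, 0, 0, by simp [h]⟩
    · exact ⟨0, r, 0, 0, 0, 0, by simp [h]⟩
    · exact ⟨0, 0, r, 0, 0, 0, by simp [h]⟩
    · exact ⟨0, 0, 0, r, 0, 0, by simp [h, pow_two]⟩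
    · exact ⟨0, 0, 0, 0, r, 0, by simp [h]⟩
    · exact ⟨0, 0, 0, 0, 0, r, by simp [h, pow_two]⟩
  rw [MvPolynomial.mem_restrictTotalDegree, MvPolynomial.totalDegree, Finset.sup_le_iff] at hp
  rw [p.as_sum]
  refine Finset.sum_induction _ (fun q => ∃ a b₀ b₁ c₀ c₁ c₂ : ℝ,
    q = MvPolynomial.C a + .C b₀ * .X 0 + .C b₁ * .X 1
        + .C c₀ * (.X 0 * .X 0) + .C c₁ * (.X 0 * .X 1) + .C c₂ * (.X 1 * .X 1)) ?_ ?_ ?_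
  · rintro _ _ ⟨a, b₀, b₁, c₀, c₁, c₂, rfl⟩ ⟨a', b₀', b₁', c₀', c₁', c₂', rfl⟩
    refine ⟨a + a', b₀ + b₀', b₁ + b₁', c₀ + c₀', c₁ + c₁', c₂ + c₂', ?_⟩
    simp only [MvPolynomial.C_add]
    ring
  · exact ⟨0, 0, 0, 0, 0, 0, by simp⟩
  · exact fun s hs => hmon s (hp s hs) _

section Polynomials

variable {Ω : Set Plane} {𝒯 : Triangulation Ω}

theorem hess_eq (y : 𝒯.Vh) (T : 𝒯.Cell) (x c : Plane) : hess y T x = hess y T c := by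
  funext i
  obtain ⟨a, b₀, b₁, c₀, c₁, c₂, hp⟩ := exists_quadratic_coeffs (y T i).2
  ext j k
  simp only [hess, Matrix.of_apply, hp]
  fin_cases j <;> fin_cases k <;> simp [MvPolynomial.pderiv_X]

theorem grad_eq_add_hess (y : 𝒯.Vh) (T : 𝒯.Cell) (x c : Plane) (i : Fin 3) (j : Fin 2) :
    grad y T x i j = grad y T c i j + ∑ k, hess y T c i j k * (x k - c k) := by
  obtain ⟨a, b₀, b₁, c₀, c₁, c₂, hp⟩ := exists_quadratic_coeffs (y T i).2
  simp only [hess, grad, Matrix.of_apply, hp, Fin.sum_univ_two]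
  fin_cases j <;> simp [MvPolynomial.pderiv_X] <;> ring

theorem val_eq_of_hess_eq_zero {y : 𝒯.Vh} {T : 𝒯.Cell} (x c : Plane) (h : hess y T c = 0) :
    val y T x = val y T c + grad y T c *ᵥ (x - c).ofLp := by
  funext i
  obtain ⟨a, b₀, b₁, c₀, c₁, c₂, hp⟩ := exists_quadratic_coeffs (y T i).2
  have h' := fun j k => congrFun (congrFun (congrFun h i) j) k
  have h₀ := h' 0 0
  have h₁ := h' 0 1
  have h₂ := h' 1 1
  simp only [hess, Matrix.of_apply, hp] at h₀ h₁ h₂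
  simp [MvPolynomial.pderiv_X] at h₀ h₁ h₂
  subst h₀ h₁ h₂
  simp only [val, grad, Matrix.mulVec, dotProduct, Pi.add_apply, Matrix.of_apply, hp,
    Fin.sum_univ_two]
  simp [MvPolynomial.pderiv_X]
  ring

theorem eq_zero_of_val_eq_zero {y : 𝒯.Vh} {T : 𝒯.Cell} (h : ∀ x, val y T x = 0) : y T = 0 := by
  funext i
  apply Subtype.ext
  refine MvPolynomial.funext fun x => ?_
  exact (congrFun (h (WithLp.toLp 2 x)) i).trans (map_zero (MvPolynomial.eval x)).symm

theorem continuous_val (y : 𝒯.Vh) (T : 𝒯.Cell) : Continuous (val y T) :=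
  continuous_pi fun i => ((y T i).1.continuous_eval).comp (by fun_prop)

theorem continuous_grad (y : 𝒯.Vh) (T : 𝒯.Cell) : Continuous (grad y T) :=
  continuous_matrix fun _ _ => (MvPolynomial.continuous_eval _).comp (by fun_prop)

theorem val_add (y w : 𝒯.Vh) (T : 𝒯.Cell) (x : Plane) :
    val (y + w) T x = val y T x + val w T x := by
  ext i; simp [val]

theorem val_smul (c : ℝ) (y : 𝒯.Vh) (T : 𝒯.Cell) (x : Plane) :
    val (c • y) T x = c • val y T x := by
  ext i; simp [val]

theorem grad_add (y w : 𝒯.Vh) (T : 𝒯.Cell) (x : Plane) :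
    grad (y + w) T x = grad y T x + grad w T x := by
  ext i; simp [grad]

theorem grad_smul (c : ℝ) (y : 𝒯.Vh) (T : 𝒯.Cell) (x : Plane) :
    grad (c • y) T x = c • grad y T x := by
  ext i; simp [grad]

theorem hess_add (y w : 𝒯.Vh) (T : 𝒯.Cell) (x : Plane) :
    hess (y + w) T x = hess y T x + hess w T x := by
  ext i; simp [hess]

theorem hess_smul (c : ℝ) (y : 𝒯.Vh) (T : 𝒯.Cell) (x : Plane) :
    hess (c • y) T x = c • hess y T x := by
  ext i; simp [hess]

/-- The linear map `y ↦ (∇_h y(x_T))_T`. -/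
def gradBary (𝒯 : Triangulation Ω) : 𝒯.Vh →ₗ[ℝ] 𝒯.Mh where
  toFun y T := grad y T (bary T.1)
  map_add' y w := by funext T; exact grad_add y w T _
  map_smul' c y := by funext T; exact grad_smul c y T _

/-- The piecewise linear function with the given piecewise constant gradient and without constant
terms. -/
def liftGrad (𝒯 : Triangulation Ω) : 𝒯.Mh →ₗ[ℝ] 𝒯.Vh where
  toFun m T i := ⟨.C (m T i 0) * .X 0 + .C (m T i 1) * .X 1, by
    rw [MvPolynomial.mem_restrictTotalDegree]
    have h : ∀ (r : ℝ) (j : Fin 2),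
        (MvPolynomial.C r * MvPolynomial.X j : MvPolynomial (Fin 2) ℝ).totalDegree ≤ 2 := by
      intro r j
      refine (MvPolynomial.totalDegree_mul _ _).trans ?_
      simp
    exact (MvPolynomial.totalDegree_add _ _).trans (max_le (h _ _) (h _ _))⟩
  map_add' m m' := by
    funext T i
    apply Subtype.ext
    simp
    ring
  map_smul' c m := by
    funext T i
    apply Subtype.ext
    simp [MvPolynomial.smul_eq_C_mul]
    ring

theorem gradBary_liftGrad (m : 𝒯.Mh) : gradBary 𝒯 (liftGrad 𝒯 m) = m := by
  funext T
  ext i j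
  simp only [gradBary, liftGrad, grad, LinearMap.coe_mk, AddHom.coe_mk, Matrix.of_apply]
  fin_cases j <;> simp [MvPolynomial.pderiv_X]

end Polynomials

/-! ### Geometry of a triangle -/

section Triangle

open MeasureTheory Filter Topology

variable {T : Finset Plane}

/-- The vertices of a nondegenerate triangle, as an affine basis of the plane. -/
def triBasis (hT : T.card = 3) (hi : AffineIndependent ℝ ((↑) : T → Plane)) :
    AffineBasis T ℝ Plane :=
  ⟨(↑), hi, by
    rw [hi.affineSpan_eq_top_iff_card_eq_finrank_add_one]
    simp [hT]⟩

theorem triBasis_apply (hT : T.card = 3) (hi : AffineIndependent ℝ ((↑) : T → Plane)) (i : T) :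
    triBasis hT hi i = i := rfl

theorem range_triBasis (hT : T.card = 3) (hi : AffineIndependent ℝ ((↑) : T → Plane)) :
    Set.range (triBasis hT hi) = T := by
  ext x
  simp [triBasis_apply]

theorem convexHull_eq_coord (hT : T.card = 3) (hi : AffineIndependent ℝ ((↑) : T → Plane)) :
    convexHull ℝ (T : Set Plane) = {x | ∀ i, 0 ≤ (triBasis hT hi).coord i x} := by
  rw [← AffineBasis.convexHull_eq_nonneg_coord, range_triBasis]

theorem affineMap_eq_sum_coord {ι W : Type*} [Fintype ι] [AddCommGroup W] [Module ℝ W]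
    (B : AffineBasis ι ℝ Plane) (φ : Plane →ᵃ[ℝ] W) (x : Plane) :
    φ x = ∑ i, B.coord i x • φ (B i) := by
  conv_lhs => rw [← B.affineCombination_coord_eq_self x]
  rw [Finset.map_affineCombination _ _ _ (B.sum_coord_apply_eq_one x),
    Finset.affineCombination_eq_linear_combination _ _ _ (B.sum_coord_apply_eq_one x)]
  rfl

theorem interior_convexHull_nonempty (hT : T.card = 3)
    (hi : AffineIndependent ℝ ((↑) : T → Plane)) :
    (interior (convexHull ℝ (T : Set Plane))).Nonempty := by
  rw [interior_convexHull_nonempty_iff_affineSpan_eq_top]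
  have h := (triBasis hT hi).tot
  rwa [range_triBasis] at h

theorem isCompact_convexHull_finset (s : Finset Plane) :
    IsCompact (convexHull ℝ (s : Set Plane)) :=
  s.finite_toSet.isCompact_convexHull ℝ

open Classical in
/-- Exchanging two vertices by an affine map preserves the triangle and the area, so all
barycentric coordinates have the same integral. -/
theorem setIntegral_coord_eq (hT : T.card = 3) (hi : AffineIndependent ℝ ((↑) : T → Plane))
    (i j : T) :
    ∫ x in convexHull ℝ (T : Set Plane), (triBasis hT hi).coord i x
      = ∫ x in convexHull ℝ (T : Set Plane), (triBasis hT hi).coord j x := by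
  set B := triBasis hT hi with hB
  set σ : Equiv.Perm T := Equiv.swap i j with hσ
  have hσσ : ∀ k, σ (σ k) = k := fun k => Equiv.swap_apply_self i j k
  -- The affine map `f` with linear part `A` permutes the vertices by the transposition `σ`.
  set A : Plane →ₗ[ℝ] Plane := (B.basisOf i).constr ℝ fun k => (σ k.1 : Plane) - σ i with hA
  have hAk : ∀ k : T, A ((k : Plane) - i) = (σ k : Plane) - σ i := by
    intro k
    by_cases hk : k = i
    · simp [hk]
    · have := (B.basisOf i).constr_basis ℝ (fun k => (σ k.1 : Plane) - σ i) ⟨k, hk⟩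
      rwa [AffineBasis.basisOf_apply] at this
  have hAA : A ∘ₗ A = LinearMap.id := by
    refine (B.basisOf i).ext fun k => ?_
    rw [AffineBasis.basisOf_apply]
    change A (A ((k.1 : Plane) - i)) = (k.1 : Plane) - i
    have e : (σ k.1 : Plane) - σ i = ((σ k.1 : Plane) - i) - ((σ i : Plane) - i) := by abel
    rw [hAk, e, map_sub, hAk, hAk, hσσ, hσσ]
    abel
  -- `f` is an involution, so its determinant is `±1` and it preserves areas.
  have hdet : LinearMap.det A * LinearMap.det A = 1 := by
    rw [← LinearMap.det_comp, hAA, LinearMap.det_id]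
  have hdet0 : LinearMap.det A ≠ 0 := fun h => by simp [h] at hdet
  have habs : |(LinearMap.det A)⁻¹| = 1 := by
    rw [abs_inv, inv_eq_one]
    rcases mul_self_eq_one_iff.1 hdet with h | h <;> simp [h]
  set f : Plane →ᵃ[ℝ] Plane := A.toAffineMap + AffineMap.const ℝ Plane ((σ i : Plane) - A i) with hf
  have hfx : ∀ x, f x = A x + ((σ i : Plane) - A i) := fun x => rfl
  have hfk : ∀ k : T, f k = σ k := by
    intro k
    rw [hfx, add_sub, add_sub_right_comm, ← map_sub, hAk, sub_add_cancel]
  have hff : ∀ x, f (f x) = x := by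
    intro x
    have h1 := affineMap_eq_sum_coord B (f.comp f) x
    have h2 := affineMap_eq_sum_coord B (AffineMap.id ℝ Plane) x
    have h3 : ∀ k, (f.comp f) (B k) = (AffineMap.id ℝ Plane) (B k) := by
      intro k
      change f (f (k : Plane)) = k
      rw [hfk, hfk, hσσ]
    simp only [h3] at h1
    exact h1.trans h2.symm
  have hcoord : ∀ k x, B.coord k (f x) = B.coord (σ k) x := by
    intro k x
    have h1 := affineMap_eq_sum_coord B ((B.coord k).comp f) x
    have h2 : ∀ l, ((B.coord k).comp f) (B l) = if l = σ k then 1 else 0 := by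
      intro l
      change B.coord k (f (l : Plane)) = _
      rw [hfk, ← triBasis_apply hT hi, ← hB, B.coord_apply]
      congr 1
      exact propext ⟨fun h => by rw [h, hσσ], fun h => by rw [h, hσσ]⟩
    simp only [h2, smul_eq_mul, mul_ite, mul_one, mul_zero, Finset.sum_ite_eq',
      Finset.mem_univ, if_true] at h1
    exact h1
  have hcont : Continuous f := f.continuous_of_finiteDimensional
  have hmp : MeasurePreserving f volume volume := by
    have h1 : MeasurePreserving A volume volume := by
      refine ⟨(LinearMap.continuous_of_finiteDimensional A).measurable, ?_⟩
      rw [Measure.map_linearMap_addHaar_eq_smul_addHaar volume hdet0, habs]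
      simp
    exact (measurePreserving_add_right volume ((σ i : Plane) - A i)).comp h1
  have hemb : MeasurableEmbedding f :=
    (MeasurableEquiv.mk ⟨f, f, hff, hff⟩ hcont.measurable hcont.measurable).measurableEmbedding
  have hpre : f ⁻¹' convexHull ℝ (T : Set Plane) = convexHull ℝ (T : Set Plane) := by
    rw [convexHull_eq_coord hT hi]
    ext x
    simp only [Set.mem_preimage, Set.mem_ofPred_eq, ← hB, hcoord]
    exact ⟨fun h k => by simpa [hσσ] using h (σ k), fun h k => h (σ k)⟩
  have := hmp.setIntegral_preimage_emb hemb (fun x => B.coord i x) (convexHull ℝ (T : Set Plane))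
  rw [hpre] at this
  rw [← this]
  simp only [hcoord, hσ, Equiv.swap_apply_left]

/-- The barycenter rule is exact for affine functions. -/
theorem setIntegral_affine (hT : T.card = 3) (hi : AffineIndependent ℝ ((↑) : T → Plane))
    (φ : Plane →ᵃ[ℝ] ℝ) :
    ∫ x in convexHull ℝ (T : Set Plane), φ x
      = volume.real (convexHull ℝ (T : Set Plane)) * φ (bary T) := by
  set B := triBasis hT hi with hB
  set K := convexHull ℝ (T : Set Plane) with hK
  have hKc : IsCompact K := isCompact_convexHull_finset T
  have hint : ∀ k, IntegrableOn (fun x => B.coord k x) K := fun k =>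
    (continuous_barycentric_coord B k).continuousOn.integrableOn_compact hKc
  have hsum : ∀ k : T, ∫ x in K, B.coord k x = volume.real K / 3 := by
    intro k
    have h1 : ∑ l, ∫ x in K, B.coord l x = volume.real K := by
      rw [← integral_finsetSum _ fun l _ => hint l]
      simp only [B.sum_coord_apply_eq_one]
      simp
    simp only [fun l => setIntegral_coord_eq hT hi l k, hB, hK] at h1
    rw [Finset.sum_const, Finset.card_univ, Fintype.card_coe, hT, nsmul_eq_mul] at h1
    rw [hK, ← h1]
    push_cast
    ring
  have hb : φ (bary T) = ∑ k : T, (1 / 3 : ℝ) * φ k := by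
    have e : bary T = ∑ k : T, (1 / 3 : ℝ) • (k : Plane) := by
      rw [bary, hT, Finset.smul_sum, ← Finset.sum_coe_sort T]
      norm_num
    have e2 := (Finset.univ : Finset T).map_affineCombination (fun k : T => (k : Plane))
      (fun _ => (1 / 3 : ℝ)) (by simp [hT]) φ
    rw [Finset.affineCombination_eq_linear_combination _ _ _ (by simp [hT]),
      Finset.affineCombination_eq_linear_combination _ _ _ (by simp [hT])] at e2
    rw [e, e2]
    rfl
  have e : ∀ x, φ x = ∑ k, B.coord k x * φ k := affineMap_eq_sum_coord B φ
  calc ∫ x in K, φ x = ∫ x in K, ∑ k, B.coord k x * φ k := by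
        exact integral_congr_ae (Eventually.of_forall e)
    _ = ∑ k : T, volume.real K / 3 * φ k := by
        rw [integral_finsetSum _ fun l _ => (hint l).mul_const _]
        simp only [integral_mul_const, hsum]
    _ = _ := by
        rw [hb, ← Finset.mul_sum, ← Finset.mul_sum]
        ring

end Triangle

/-! ### Sides of an edge -/

section Sides

open Filter Topology

/-- The affine function `z ↦ n · (z - m_e)`, with `m_e` the midpoint of the edge `e`. -/
def sideMap (n : Plane) (e : Finset Plane) : Plane →ᵃ[ℝ] ℝ :=
  (innerₗ Plane n).toAffineMap - AffineMap.const ℝ Plane (inner ℝ n (bary e))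

theorem sideMap_apply (n : Plane) (e : Finset Plane) (z : Plane) :
    sideMap n e z = inner ℝ n (z - bary e) := by
  rw [inner_sub_right]
  rfl

theorem bary_pair {p q : Plane} (hpq : p ≠ q) :
    bary {p, q} = (1 / 2 : ℝ) • p + (1 / 2 : ℝ) • q := by
  rw [bary, Finset.card_pair hpq, Finset.sum_pair hpq, smul_add]
  norm_num

theorem exists_of_mem_openEdge {p q x : Plane} (hx : x ∈ openEdge {p, q}) :
    ∃ s t : ℝ, 0 < s ∧ 0 < t ∧ s + t = 1 ∧ x = s • p + t • q := by
  obtain ⟨h1, h2⟩ := hx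
  rw [Finset.coe_pair, convexHull_pair] at h1
  obtain ⟨s, t, hs, ht, hst, rfl⟩ := h1
  refine ⟨s, t, hs.lt_of_ne' ?_, ht.lt_of_ne' ?_, hst, rfl⟩
  · rintro rfl
    exact h2 (by simp [show t = 1 by linarith])
  · rintro rfl
    exact h2 (by simp [show s = 1 by linarith])

theorem bary_mem_openEdge {e : Finset Plane} (he : e.card = 2) : bary e ∈ openEdge e := by
  obtain ⟨p, q, hpq, rfl⟩ := Finset.card_eq_two.1 he
  rw [bary_pair hpq]
  refine ⟨?_, ?_⟩
  · rw [Finset.coe_pair, convexHull_pair]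
    exact ⟨1 / 2, 1 / 2, by norm_num, by norm_num, by norm_num, rfl⟩
  · intro h
    have key : ∀ r : Plane, (1 / 2 : ℝ) • p + (1 / 2 : ℝ) • q = r → p - r = r - q := by
      rintro r rfl
      module
    simp only [Finset.coe_pair, Set.mem_insert_iff, Set.mem_singleton_iff] at h
    rcases h with h | h
    · have := key _ h
      rw [sub_self] at this
      exact hpq (sub_eq_zero.1 this.symm)
    · have := key _ h
      rw [sub_self] at this
      exact hpq (sub_eq_zero.1 this)

theorem sideMap_eq_zero {e : Finset Plane} (he : e.card = 2) {n : Plane}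
    (hn : ∀ a ∈ e, ∀ b ∈ e, inner ℝ n (b - a) = 0) {x : Plane}
    (hx : x ∈ convexHull ℝ (e : Set Plane)) : sideMap n e x = 0 := by
  obtain ⟨p, q, hpq, rfl⟩ := Finset.card_eq_two.1 he
  rw [Finset.coe_pair, convexHull_pair] at hx
  obtain ⟨s, t, hs, ht, hst, rfl⟩ := hx
  have h := hn p (by simp) q (by simp)
  rw [sideMap_apply, bary_pair hpq]
  have : s • p + t • q - ((1 / 2 : ℝ) • p + (1 / 2 : ℝ) • q) = (t - 1 / 2) • (q - p) := by
    rw [show s = 1 - t by linarith]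
    module
  rw [this, inner_smul_right, h, mul_zero]

variable {T e : Finset Plane} {n : Plane}

/-- The coordinate belonging to the vertex opposite to an edge measures the signed distance to
that edge. -/
theorem exists_apex (hT : T.card = 3) (hi : AffineIndependent ℝ ((↑) : T → Plane))
    (he : e.card = 2) (heT : e ⊆ T) (hn0 : n ≠ 0)
    (hn : ∀ a ∈ e, ∀ b ∈ e, inner ℝ n (b - a) = 0) :
    sideMap n e (bary T) ≠ 0 ∧ ∃ a : T, (∀ i : T, i ≠ a → (i : Plane) ∈ e) ∧
      ∀ z, sideMap n e z = (triBasis hT hi).coord a z * (3 * sideMap n e (bary T)) := by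
  classical
  obtain ⟨a, hae, haT⟩ := (Finset.exists_eq_insert_iff (s := e) (t := T)).2 ⟨heT, by omega⟩
  have haT' : a ∈ T := haT ▸ Finset.mem_insert_self a e
  have hmem : ∀ i : T, i ≠ ⟨a, haT'⟩ → (i : Plane) ∈ e := by
    intro i hia
    have h := haT.symm.subset i.2
    exact (Finset.mem_insert.1 h).resolve_left fun h => hia (Subtype.ext h)
  have hz : ∀ z, sideMap n e z = (triBasis hT hi).coord ⟨a, haT'⟩ z * sideMap n e a := by
    intro z
    rw [affineMap_eq_sum_coord (triBasis hT hi) (sideMap n e) z,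
      Finset.sum_eq_single_of_mem ⟨a, haT'⟩ (Finset.mem_univ _)]
    · rfl
    · intro i _ hia
      rw [triBasis_apply, sideMap_eq_zero he hn (subset_convexHull ℝ _ (hmem i hia)), smul_zero]
  -- Otherwise the side function would vanish identically, but it is `|n|²` at `bary e + n`.
  have hne : sideMap n e a ≠ 0 := by
    intro h0
    have h1 := hz (bary e + n)
    rw [h0, mul_zero, sideMap_apply, add_sub_cancel_left, real_inner_self_eq_norm_sq] at h1
    exact hn0 (norm_eq_zero.1 (pow_eq_zero_iff two_ne_zero |>.1 h1))
  have hb : sideMap n e a = 3 * sideMap n e (bary T) := by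
    have hsum : ∑ v ∈ T, sideMap n e v = sideMap n e a := by
      rw [← haT, Finset.sum_insert hae, Finset.sum_eq_zero, add_zero]
      exact fun v hv => sideMap_eq_zero he hn (subset_convexHull ℝ _ hv)
    rw [← hsum]
    simp only [sideMap_apply]
    rw [← inner_sum, Finset.sum_sub_distrib, Finset.sum_const, hT, ← real_inner_smul_right]
    congr 1
    have h : bary T = (3 : ℝ)⁻¹ • ∑ v ∈ T, v := by rw [bary, hT]; norm_num
    rw [h]
    module
  refine ⟨fun h => hne (by rw [hb, h, mul_zero]), ⟨a, haT'⟩, hmem, fun z => ?_⟩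
  rw [← hb]
  exact hz z

/-- Near an interior point of an edge, a triangle coincides with a half plane. -/
theorem eventually_mem_convexHull (hT : T.card = 3) (hi : AffineIndependent ℝ ((↑) : T → Plane))
    (he : e.card = 2) (heT : e ⊆ T) (hn0 : n ≠ 0)
    (hn : ∀ a ∈ e, ∀ b ∈ e, inner ℝ n (b - a) = 0) {x : Plane} (hx : x ∈ openEdge e) :
    ∀ᶠ z in 𝓝 x, 0 ≤ sideMap n e z * sideMap n e (bary T) →
      z ∈ convexHull ℝ (T : Set Plane) := by
  classical
  obtain ⟨hb, a, hae, ha⟩ := exists_apex hT hi he heT hn0 hn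
  set B := triBasis hT hi with hB
  have hpos : ∀ i : T, (i : Plane) ∈ e → 0 < B.coord i x := by
    obtain ⟨p, q, hpq, rfl⟩ := Finset.card_eq_two.1 he
    obtain ⟨s, t, hs, ht, hst, rfl⟩ := exists_of_mem_openEdge hx
    have hp : p ∈ T := heT (by simp)
    have hq : q ∈ T := heT (by simp)
    intro i hie
    have e1 : B.coord i p = if i = ⟨p, hp⟩ then 1 else 0 := B.coord_apply i ⟨p, hp⟩
    have e2 : B.coord i q = if i = ⟨q, hq⟩ then 1 else 0 := B.coord_apply i ⟨q, hq⟩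
    rw [Convex.combo_affine_apply hst, e1, e2]
    simp only [Finset.mem_insert, Finset.mem_singleton] at hie
    simp only [Subtype.ext_iff]
    rcases hie with h | h <;> simp [h, hpq, hpq.symm, hs, ht]
  have hev : ∀ᶠ z in 𝓝 x, ∀ i : T, (i : Plane) ∈ e → 0 < B.coord i z := by
    refine eventually_all.2 fun i => ?_
    by_cases hie : (i : Plane) ∈ e
    · filter_upwards [(continuous_barycentric_coord B i).continuousAt.eventually
        (lt_mem_nhds (hpos i hie))] with z hz _ using hz
    · exact Eventually.of_forall fun z h => absurd h hie
  filter_upwards [hev] with z hz hside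
  rw [convexHull_eq_coord hT hi]
  intro i
  by_cases hia : i = a
  · rw [ha z] at hside
    subst hia
    have : 0 < sideMap n e (bary T) ^ 2 := by positivity
    by_contra! hlt
    nlinarith
  · exact (hz i (hae i hia)).le

theorem exists_normal (he : e.card = 2) :
    ∃ n : Plane, n ≠ 0 ∧ ∀ a ∈ e, ∀ b ∈ e, inner ℝ n (b - a) = 0 := by
  obtain ⟨p, q, hpq, rfl⟩ := Finset.card_eq_two.1 he
  refine ⟨!₂[-(q 1 - p 1), q 0 - p 0], fun h => hpq ?_, ?_⟩
  · have h0 := congrArg (fun v : Plane => v 0) h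
    have h1 := congrArg (fun v : Plane => v 1) h
    simp at h0 h1
    ext i
    fin_cases i <;> simp <;> linarith
  · intro a ha b hb
    simp only [Finset.mem_insert, Finset.mem_singleton] at ha hb
    rcases ha with rfl | rfl <;> rcases hb with rfl | rfl <;>
      simp [PiLp.inner_apply, Fin.sum_univ_two] <;> ring

end Sides

/-! ### Adjacency of cells -/

section Mesh

open Filter Topology

variable {Ω : Set Plane} {𝒯 : Triangulation Ω}

theorem mem_cells {T : Finset Plane} : T ∈ 𝒯.cells ↔ T ∈ 𝒯.complex.faces ∧ T.card = 3 := by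
  simp [cells]

theorem mem_edges {e : Finset Plane} : e ∈ 𝒯.edges ↔ e ∈ 𝒯.complex.faces ∧ e.card = 2 := by
  simp [edges]

theorem cell_card (T : 𝒯.Cell) : T.1.card = 3 := (mem_cells.1 T.2).2

theorem cell_indep (T : 𝒯.Cell) : AffineIndependent ℝ ((↑) : T.1 → Plane) :=
  𝒯.complex.indep (mem_cells.1 T.2).1

theorem cell_subset_closure (T : 𝒯.Cell) : convexHull ℝ (T.1 : Set Plane) ⊆ closure Ω :=
  𝒯.space_eq ▸ 𝒯.complex.convexHull_subset_space (mem_cells.1 T.2).1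

theorem side_ne_zero {e : Finset Plane} (he : e.card = 2) {n : Plane} (hn0 : n ≠ 0)
    (hn : ∀ a ∈ e, ∀ b ∈ e, inner ℝ n (b - a) = 0) {T : 𝒯.Cell} (heT : e ⊆ T.1) :
    inner ℝ n (bary T.1 - bary e) ≠ 0 := by
  rw [← sideMap_apply]
  exact (exists_apex (cell_card T) (cell_indep T) he heT hn0 hn).1

/-- There is at most one triangle on each side of an edge. -/
theorem cell_eq_of_same_side {e : Finset Plane} (he : e.card = 2) {n : Plane} (hn0 : n ≠ 0)
    (hn : ∀ a ∈ e, ∀ b ∈ e, inner ℝ n (b - a) = 0) {T T' : 𝒯.Cell} (heT : e ⊆ T.1)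
    (heT' : e ⊆ T'.1)
    (hside : 0 < inner ℝ n (bary T.1 - bary e) * inner ℝ n (bary T'.1 - bary e)) : T = T' := by
  classical
  by_contra hne
  rw [← sideMap_apply, ← sideMap_apply] at hside
  have hinter : T.1 ∩ T'.1 = e := by
    have h1 : e ⊆ T.1 ∩ T'.1 := Finset.subset_inter heT heT'
    refine (Finset.eq_of_subset_of_card_le h1 ?_).symm
    by_contra! hlt
    have h2 : T.1 ∩ T'.1 = T.1 :=
      Finset.eq_of_subset_of_card_le Finset.inter_subset_left (by rw [cell_card T]; omega)
    have h3 : T.1 ∩ T'.1 = T'.1 :=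
      Finset.eq_of_subset_of_card_le Finset.inter_subset_right (by rw [cell_card T']; omega)
    exact hne (Subtype.ext (h2.symm.trans h3))
  have hx := bary_mem_openEdge he
  set s := sideMap n e (bary T.1) with hs
  have hs0 : s ≠ 0 := fun h => by simp [h] at hside
  -- Points slightly off the midpoint, on the common side, lie in both triangles but not on `e`.
  have hlim : Tendsto (fun t : ℝ => bary e + (t * s) • n) (𝓝[>] 0) (𝓝 (bary e)) := by
    have : Continuous fun t : ℝ => bary e + (t * s) • n := by fun_prop
    simpa using (this.tendsto 0).mono_left nhdsWithin_le_nhds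
  have hev := (hlim.eventually
    (eventually_mem_convexHull (cell_card T) (cell_indep T) he heT hn0 hn hx)).and
    (hlim.eventually
      (eventually_mem_convexHull (cell_card T') (cell_indep T') he heT' hn0 hn hx))
  obtain ⟨t, ⟨h1, h2⟩, ht⟩ := (hev.and self_mem_nhdsWithin).exists
  have ht0 : 0 < t := ht
  have hval : sideMap n e (bary e + (t * s) • n) = t * s * ‖n‖ ^ 2 := by
    rw [sideMap_apply, add_sub_cancel_left, inner_smul_right, real_inner_self_eq_norm_sq]
  have hnn : 0 < ‖n‖ ^ 2 := by positivity
  rw [hval] at h1 h2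
  have m1 := h1 (by
    rw [← hs, show t * s * ‖n‖ ^ 2 * s = t * ‖n‖ ^ 2 * s ^ 2 by ring]; positivity)
  have m2 := h2 (by
    rw [show t * s * ‖n‖ ^ 2 * sideMap n e (bary T'.1)
      = t * ‖n‖ ^ 2 * (s * sideMap n e (bary T'.1)) by ring]
    positivity)
  have m3 := 𝒯.complex.inter_subset_convexHull (mem_cells.1 T.2).1 (mem_cells.1 T'.2).1 ⟨m1, m2⟩
  rw [← Finset.coe_inter, hinter] at m3
  have m4 := sideMap_eq_zero he hn m3
  rw [hval] at m4
  have : t * s * ‖n‖ ^ 2 ≠ 0 := by positivity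
  exact this m4

/-- An edge shared by two triangles is an internal edge. -/
theorem mem_interiorEdges_of_shared (hreg : interior (closure Ω) = Ω) {e : Finset Plane}
    (he : e.card = 2) {T T' : 𝒯.Cell} (hne : T ≠ T') (heT : e ⊆ T.1) (heT' : e ⊆ T'.1) :
    e ∈ 𝒯.interiorEdges := by
  obtain ⟨n, hn0, hn⟩ := exists_normal he
  have hface : e ∈ 𝒯.complex.faces :=
    𝒯.complex.down_closed (mem_cells.1 T.2).1 heT (Finset.card_pos.1 (by omega))
  simp only [interiorEdges, Finset.mem_filter]
  refine ⟨mem_edges.2 ⟨hface, he⟩, fun x hx => ?_⟩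
  rw [← hreg, mem_interior_iff_mem_nhds]
  filter_upwards [eventually_mem_convexHull (cell_card T) (cell_indep T) he heT hn0 hn hx,
    eventually_mem_convexHull (cell_card T') (cell_indep T') he heT' hn0 hn hx] with z h1 h2
  -- The two triangles lie on opposite sides of `e`, so every `z` near `x` is in one of them.
  by_cases hz : 0 ≤ sideMap n e z * sideMap n e (bary T.1)
  · exact cell_subset_closure T (h1 hz)
  · refine cell_subset_closure T' (h2 ?_)
    have h3 : ¬ 0 < sideMap n e (bary T.1) * sideMap n e (bary T'.1) := fun h =>
      hne (cell_eq_of_same_side he hn0 hn heT heT' (by simpa only [sideMap_apply] using h))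
    push Not at hz h3
    by_contra! h4
    have h5 := mul_pos_of_neg_of_neg hz h4
    have h6 : 0 ≤ sideMap n e z ^ 2 := sq_nonneg _
    nlinarith [mul_nonneg h6 (neg_nonneg.2 h3)]

/-! ### Edge-connectedness of the mesh -/

theorem isPreconnected_punctured_ball (v : Plane) (r : ℝ) :
    IsPreconnected (Metric.ball v r \ {v}) := by
  have hrank : 1 < Module.rank ℝ Plane := by
    rw [← Module.finrank_eq_rank, finrank_euclideanSpace]
    simp
  have h := ((isPreconnected_sphere hrank (0 : Plane) 1).prod
    (isPreconnected_Ioo (a := (0 : ℝ)) (b := r))).image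
    (fun p : Plane × ℝ => v + p.2 • p.1) (by fun_prop)
  convert h
  ext x
  simp only [Set.mem_sdiff, Metric.mem_ball, Set.mem_singleton_iff, Set.mem_image, Set.mem_prod,
    mem_sphere_zero_iff_norm, Set.mem_Ioo, Prod.exists]
  constructor
  · rintro ⟨h1, h2⟩
    have h3 : 0 < ‖x - v‖ := norm_pos_iff.2 (sub_ne_zero.2 h2)
    refine ⟨‖x - v‖⁻¹ • (x - v), ‖x - v‖, ⟨?_, h3, by rwa [← dist_eq_norm]⟩, ?_⟩
    · rw [norm_smul, norm_inv, norm_norm, inv_mul_cancel₀ h3.ne']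
    · rw [smul_smul, mul_inv_cancel₀ h3.ne', one_smul, add_sub_cancel]
  · rintro ⟨u, t, ⟨hu, ht0, htr⟩, rfl⟩
    have hnorm : ‖t • u‖ = t := by rw [norm_smul, hu, mul_one, Real.norm_of_nonneg ht0.le]
    refine ⟨by rw [dist_eq_norm, add_sub_cancel_left, hnorm]; exact htr, fun h => ?_⟩
    rw [add_eq_left] at h
    rw [h, norm_zero] at hnorm
    exact ht0.ne hnorm

theorem isPreconnected_diff_singleton {U : Set Plane} (hU : IsOpen U) (hc : IsPreconnected U)
    (v : Plane) : IsPreconnected (U \ {v}) := by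
  by_cases hv : v ∈ U
  swap
  · rwa [Set.sdiff_singleton_eq_self hv]
  obtain ⟨r, hr, hB⟩ := Metric.isOpen_iff.1 hU v hv
  have hsub : Metric.ball v r \ {v} ⊆ U \ {v} := Set.sdiff_subset_sdiff_left hB
  have key : ∀ a b : Set Plane, IsOpen a → IsOpen b → U \ {v} ⊆ a ∪ b →
      U \ {v} ∩ (a ∩ b) = ∅ → Metric.ball v r \ {v} ⊆ a → U \ {v} ⊆ a := by
    intro a b ha hb hab hdisj hPa
    have hu := isPreconnected_iff_subset_of_disjoint.1 hc (a ∪ Metric.ball v r) (b \ {v})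
      (ha.union Metric.isOpen_ball) (hb.sdiff isClosed_singleton) ?_ ?_
    · rcases hu with hu | hu
      · rintro x ⟨hxU, hxv⟩
        rcases hu hxU with h | h
        · exact h
        · exact hPa ⟨h, hxv⟩
      · exact absurd rfl (hu hv).2
    · intro x hx
      by_cases hxv : x = v
      · subst hxv
        exact Or.inl (Or.inr (Metric.mem_ball_self hr))
      · rcases hab ⟨hx, hxv⟩ with h | h
        · exact Or.inl (Or.inl h)
        · exact Or.inr ⟨h, hxv⟩
    · rw [Set.eq_empty_iff_forall_notMem] at hdisj ⊢
      rintro x ⟨hxU, hx1, hxb, hxv⟩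
      refine hdisj x ⟨⟨hxU, hxv⟩, ?_, hxb⟩
      rcases hx1 with h | h
      · exact h
      · exact hPa ⟨h, hxv⟩
  refine isPreconnected_iff_subset_of_disjoint.2 fun a b ha hb hab hdisj => ?_
  have hP := isPreconnected_iff_subset_of_disjoint.1 (isPreconnected_punctured_ball v r) a b ha hb
    (hsub.trans hab) (Set.subset_eq_empty (Set.inter_subset_inter_left _ hsub) hdisj)
  rcases hP with hP | hP
  · exact Or.inl (key a b ha hb hab hdisj hP)
  · exact Or.inr (key b a hb ha (Set.union_comm a b ▸ hab) (Set.inter_comm a b ▸ hdisj) hP)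

theorem isPreconnected_diff_finite {U : Set Plane} (hU : IsOpen U) (hc : IsPreconnected U)
    {F : Set Plane} (hF : F.Finite) : IsPreconnected (U \ F) := by
  induction F, hF using Set.Finite.induction_on with
  | empty => simpa using hc
  | @insert a s _ hs ih =>
    have : U \ insert a s = (U \ s) \ {a} := by
      ext x; simp; tauto
    rw [this]
    exact isPreconnected_diff_singleton (hU.sdiff hs.isClosed) ih a

/-- A property which passes from a triangle to its neighbours across internal edges holds for all
triangles: the domain without the vertices of the mesh is still connected, and away from the
vertices, triangles only meet in internal edges. -/
theorem cell_induction (hΩ : IsOpen Ω) (hc : IsConnected Ω) (hreg : interior (closure Ω) = Ω)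
    {P : 𝒯.Cell → Prop} {T₀ : 𝒯.Cell} (h₀ : P T₀)
    (hstep : ∀ T T' : 𝒯.Cell, ∀ e ∈ 𝒯.interiorEdges, e ⊆ T.1 → e ⊆ T'.1 → T ≠ T' → P T → P T')
    (T : 𝒯.Cell) : P T := by
  classical
  by_contra hT
  set F : Set Plane := ⋃ T : 𝒯.Cell, (T.1 : Set Plane) with hF
  have hFf : F.Finite := Set.finite_iUnion fun T => T.1.finite_toSet
  have hpre := isPreconnected_diff_finite hΩ hc.isPreconnected hFf
  have hclosed : ∀ Q : 𝒯.Cell → Prop,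
      IsClosed (⋃ T : {T : 𝒯.Cell // Q T}, convexHull ℝ (T.1.1 : Set Plane)) := fun Q =>
    isClosed_iUnion_of_finite fun T => (isCompact_convexHull_finset _).isClosed
  have hmeet : ∀ Q : 𝒯.Cell → Prop, ∀ T, Q T →
      (Ω \ F ∩ ⋃ T : {T : 𝒯.Cell // Q T}, convexHull ℝ (T.1.1 : Set Plane)).Nonempty := by
    intro Q T hQ
    obtain ⟨x, hx1, hx2⟩ := (hFf.countable.dense_compl ℝ).inter_open_nonempty _ isOpen_interior
      (interior_convexHull_nonempty (cell_card T) (cell_indep T))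
    refine ⟨x, ⟨?_, hx2⟩, Set.mem_iUnion.2 ⟨⟨T, hQ⟩, interior_subset hx1⟩⟩
    rw [← hreg]
    exact interior_mono (cell_subset_closure T) hx1
  have hcover : Ω \ F ⊆ (⋃ T : {T : 𝒯.Cell // P T}, convexHull ℝ (T.1.1 : Set Plane)) ∪
      ⋃ T : {T : 𝒯.Cell // ¬ P T}, convexHull ℝ (T.1.1 : Set Plane) := by
    rintro x ⟨hx, -⟩
    have hx' : x ∈ 𝒯.complex.space := 𝒯.space_eq ▸ subset_closure hx
    obtain ⟨s, hs, hxs⟩ := Geometry.SimplicialComplex.mem_space_iff.1 hx'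
    obtain ⟨t, ht, hst, hcard⟩ := 𝒯.pure s hs
    have hxt := convexHull_mono (𝕜 := ℝ) (Finset.coe_subset.2 hst) hxs
    by_cases hP : P ⟨t, mem_cells.2 ⟨ht, hcard⟩⟩
    · exact Or.inl (Set.mem_iUnion.2 ⟨⟨_, hP⟩, hxt⟩)
    · exact Or.inr (Set.mem_iUnion.2 ⟨⟨_, hP⟩, hxt⟩)
  obtain ⟨x, ⟨-, hxF⟩, hx1, hx2⟩ := isPreconnected_closed_iff.1 hpre _ _ (hclosed P)
    (hclosed fun T => ¬ P T) hcover (hmeet P T₀ h₀) (hmeet (fun T => ¬ P T) T hT)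
  -- `x` lies in two triangles, hence in the hull of their common vertices; the case of one common
  -- vertex is excluded as the vertices have been removed.
  obtain ⟨⟨A, hA⟩, hxA⟩ := Set.mem_iUnion.1 hx1
  obtain ⟨⟨B, hB⟩, hxB⟩ := Set.mem_iUnion.1 hx2
  have hAB : A ≠ B := fun h => hB (h ▸ hA)
  have hxAB := 𝒯.complex.inter_subset_convexHull (mem_cells.1 A.2).1 (mem_cells.1 B.2).1 ⟨hxA, hxB⟩
  rw [← Finset.coe_inter] at hxAB
  have hcard : (A.1 ∩ B.1).card < 3 := by
    by_contra! hle
    have h2 : A.1 ∩ B.1 = A.1 :=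
      Finset.eq_of_subset_of_card_le Finset.inter_subset_left (by rw [cell_card A]; omega)
    have h3 : A.1 ∩ B.1 = B.1 :=
      Finset.eq_of_subset_of_card_le Finset.inter_subset_right (by rw [cell_card B]; omega)
    exact hAB (Subtype.ext (h2.symm.trans h3))
  obtain h | h | h : (A.1 ∩ B.1).card = 0 ∨ (A.1 ∩ B.1).card = 1 ∨ (A.1 ∩ B.1).card = 2 := by
    omega
  · rw [Finset.card_eq_zero.1 h] at hxAB
    simp at hxAB
  · obtain ⟨v, hv⟩ := Finset.card_eq_one.1 h
    rw [hv, Finset.coe_singleton, convexHull_singleton, Set.mem_singleton_iff] at hxAB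
    have hvA : v ∈ A.1 := Finset.inter_subset_left (hv ▸ Finset.mem_singleton_self v)
    exact hxF (hxAB ▸ Set.mem_iUnion.2 ⟨A, hvA⟩)
  · exact hB (hstep A B _ (mem_interiorEdges_of_shared hreg h hAB Finset.inter_subset_left
      Finset.inter_subset_right) Finset.inter_subset_left Finset.inter_subset_right hAB hA)

end Mesh

/-! ### Frobenius norm and the exponential map of the Stiefel manifold -/

section Frobenius

attribute [local instance] Matrix.frobeniusNormedAddCommGroup Matrix.frobeniusNormedSpace
  Matrix.frobeniusNormedRing Matrix.frobeniusNormedAlgebra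

theorem frob_self {m n : Type*} [Fintype m] [Fintype n] (A : Matrix m n ℝ) :
    frob A A = ‖A‖ ^ 2 := by
  rw [Matrix.frobenius_norm_def, ← Real.sqrt_eq_rpow, Real.sq_sqrt (by positivity)]
  simp [frob, pow_two]

theorem abs_frob_le {m n : Type*} [Fintype m] [Fintype n] (A B : Matrix m n ℝ) :
    |frob A B| ≤ ‖A‖ * ‖B‖ := by
  refine abs_le_of_sq_le_sq ?_ (by positivity)
  rw [mul_pow, ← frob_self, ← frob_self]
  simp only [frob, ← Finset.sum_product', ← pow_two]
  exact Finset.sum_mul_sq_le_sq_mul_sq _ _ _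

theorem frob_add_right {m n : Type*} [Fintype m] [Fintype n] (A B C : Matrix m n ℝ) :
    frob A (B + C) = frob A B + frob A C := by
  simp [frob, mul_add, Finset.sum_add_distrib]

theorem frob_smul_right {m n : Type*} [Fintype m] [Fintype n] (A B : Matrix m n ℝ) (c : ℝ) :
    frob A (c • B) = c * frob A B := by
  simp [frob, Finset.mul_sum, mul_left_comm]

theorem norm_le_of_mem_stiefel {U : Matrix (Fin 3) (Fin 2) ℝ} (hU : U ∈ Stiefel) : ‖U‖ ≤ 2 := by
  have h : ‖U‖ ^ 2 = 2 := by
    have h0 : Uᵀ * U = 1 := hU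
    have h1 := congrFun (congrFun h0 0) 0
    have h2 := congrFun (congrFun h0 1) 1
    simp [Matrix.mul_apply, Fin.sum_univ_three] at h1 h2
    rw [← frob_self]
    simp only [frob, Fin.sum_univ_three, Fin.sum_univ_two]
    linarith
  nlinarith [norm_nonneg U]

/-- Tangent vectors at `U` are orthogonal to the normal vectors `U γ`, `γ` symmetric. -/
theorem frob_mul_eq_zero {U W : Matrix (Fin 3) (Fin 2) ℝ} {γ : Matrix (Fin 2) (Fin 2) ℝ}
    (hγ : γᵀ = γ) (hW : Uᵀ * W + Wᵀ * U = 0) : frob W (U * γ) = 0 := by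
  have h : ∀ i j, (Uᵀ * W + Wᵀ * U) i j = 0 := fun i j => by rw [hW]; rfl
  have h00 := h 0 0
  have h01 := h 0 1
  have h11 := h 1 1
  have hs : γ 1 0 = γ 0 1 := congrFun (congrFun hγ 0) 1
  simp only [Matrix.add_apply, Matrix.mul_apply, Matrix.transpose_apply,
    Fin.sum_univ_three] at h00 h01 h11
  simp only [frob, Matrix.mul_apply, Fin.sum_univ_three, Fin.sum_univ_two, hs]
  linear_combination γ 0 0 / 2 * h00 + γ 0 1 * h01 + γ 1 1 / 2 * h11

/-- Second-order expansion of the matrix exponential at `0`. -/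
theorem exists_norm_exp_sub_le (n : Type*) [Fintype n] [DecidableEq n] :
    ∃ c δ : ℝ, 0 < c ∧ 0 < δ ∧ ∀ X : Matrix n n ℝ, ‖X‖ ≤ δ →
      ‖NormedSpace.exp X - 1 - X‖ ≤ c * ‖X‖ ^ 2 := by
  have h := (NormedSpace.exp_hasFPowerSeriesAt_zero (𝕂 := ℝ)
    (𝔸 := Matrix n n ℝ)).isBigO_sub_partialSum_pow 2
  obtain ⟨c, hc, h⟩ := h.exists_pos
  obtain ⟨δ, hδ, h⟩ := Metric.eventually_nhds_iff.1 h.bound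
  refine ⟨c, δ / 2, hc, by positivity, fun X hX => ?_⟩
  have := h (y := X) (by rw [dist_zero_right]; linarith)
  simp only [FormalMultilinearSeries.partialSum, Finset.sum_range_succ, Finset.sum_range_zero,
    NormedSpace.expSeries_apply_eq, zero_add, Nat.factorial, pow_zero, pow_one, Nat.cast_one,
    inv_one, one_smul, norm_pow, norm_norm, mul_one] at this
  rw [sub_sub]
  exact this

/-- The exponential map of the Stiefel manifold is a first-order retraction, with a quadratic
remainder which is uniform in the base point. -/
theorem exists_norm_stiefelExp_sub_le :
    ∃ C δ : ℝ, 0 < C ∧ 0 < δ ∧ ∀ U ∈ Stiefel, ∀ W : Matrix (Fin 3) (Fin 2) ℝ,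
      Uᵀ * W + Wᵀ * U = 0 → ‖W‖ ≤ δ → ‖stiefelExp U W - U - W‖ ≤ C * ‖W‖ ^ 2 := by
  obtain ⟨c, δ, hc, hδ, h⟩ := exists_norm_exp_sub_le (Fin 3)
  obtain ⟨c', δ', hc', hδ', h'⟩ := exists_norm_exp_sub_le (Fin 2)
  refine ⟨32 * c + 8 * c' + (4 + 16 * c) * 2 * (2 + 4 * c'), min 1 (min (δ / 4) (δ' / 2)),
    by positivity, by positivity, fun U hU W hW hWδ => ?_⟩
  have hU2 := norm_le_of_mem_stiefel hU
  have hW1 : ‖W‖ ≤ 1 := hWδ.trans (min_le_left _ _)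
  have hW2 : ‖W‖ ≤ δ / 4 := hWδ.trans ((min_le_right _ _).trans (min_le_left _ _))
  have hW3 : ‖W‖ ≤ δ' / 2 := hWδ.trans ((min_le_right _ _).trans (min_le_right _ _))
  have hw := norm_nonneg W
  set X := W * Uᵀ - U * Wᵀ with hXdef
  set Y := -(Uᵀ * W) with hYdef
  have hX : ‖X‖ ≤ 4 * ‖W‖ := by
    have h1 := Matrix.frobenius_norm_mul W Uᵀ
    have h2 := Matrix.frobenius_norm_mul U Wᵀ
    rw [Matrix.frobenius_norm_transpose] at h1 h2
    have h3 := norm_sub_le (W * Uᵀ) (U * Wᵀ)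
    nlinarith
  have hY : ‖Y‖ ≤ 2 * ‖W‖ := by
    have h1 := Matrix.frobenius_norm_mul Uᵀ W
    rw [Matrix.frobenius_norm_transpose] at h1
    rw [hYdef, norm_neg]
    nlinarith
  have hR := h X (by linarith)
  have hS := h' Y (by linarith)
  set R := NormedSpace.exp X - 1 - X with hRdef
  set S := NormedSpace.exp Y - 1 - Y with hSdef
  have hR' : ‖R‖ ≤ 16 * c * ‖W‖ ^ 2 := by
    have : ‖X‖ ^ 2 ≤ (4 * ‖W‖) ^ 2 := by gcongr
    nlinarith
  have hS' : ‖S‖ ≤ 4 * c' * ‖W‖ ^ 2 := by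
    have : ‖Y‖ ^ 2 ≤ (2 * ‖W‖) ^ 2 := by gcongr
    nlinarith
  have hsq : ‖W‖ ^ 2 ≤ ‖W‖ := by nlinarith
  have hXR : ‖X + R‖ ≤ (4 + 16 * c) * ‖W‖ := (norm_add_le _ _).trans (by nlinarith)
  have hYS : ‖Y + S‖ ≤ (2 + 4 * c') * ‖W‖ := (norm_add_le _ _).trans (by nlinarith)
  -- The derivative at `0` is `W - U (Wᵀ U + Uᵀ W)`, which is `W` for tangent `W`.
  have hlin : X * U + U * Y = W := by
    have hUU : Uᵀ * U = 1 := hU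
    rw [hXdef, hYdef, Matrix.sub_mul, Matrix.mul_assoc, hUU, Matrix.mul_one, Matrix.mul_neg,
      Matrix.mul_assoc, sub_add_eq_add_sub, add_sub_assoc, ← neg_add', ← Matrix.mul_add, hW]
    simp
  have hexp : stiefelExp U W - U - W = R * U + U * S + (X + R) * U * (Y + S) := by
    have e1 : NormedSpace.exp X = 1 + X + R := by rw [hRdef]; abel
    have e2 : NormedSpace.exp Y = 1 + Y + S := by rw [hSdef]; abel
    rw [stiefelExp, ← hXdef, ← hYdef, e1, e2]
    conv_lhs => rw [← hlin]
    simp only [Matrix.add_mul, Matrix.mul_add, Matrix.one_mul, Matrix.mul_one]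
    abel
  rw [hexp]
  have n1 : ‖R * U‖ ≤ 16 * c * ‖W‖ ^ 2 * 2 :=
    (Matrix.frobenius_norm_mul _ _).trans (by gcongr)
  have n2 : ‖U * S‖ ≤ 2 * (4 * c' * ‖W‖ ^ 2) :=
    (Matrix.frobenius_norm_mul _ _).trans (by gcongr)
  have n3 : ‖(X + R) * U * (Y + S)‖ ≤ (4 + 16 * c) * ‖W‖ * 2 * ((2 + 4 * c') * ‖W‖) :=
    (Matrix.frobenius_norm_mul _ _).trans (by
      gcongr
      exact (Matrix.frobenius_norm_mul _ _).trans (by gcongr))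
  refine (norm_add₃_le).trans ?_
  nlinarith

/-! ### The dissipation argument in finite dimensions -/

section Abstract

variable {V ι : Type*} [NormedAddCommGroup V] [InnerProductSpace ℝ V] [FiniteDimensional ℝ V]
  [Fintype ι]

/-- The discrete proximal system in a finite-dimensional inner product space `V`, with
elementwise gradients `G`, cell areas `ω` and data `Λ`. -/
structure IsAbstractStep (ω : ι → ℝ) (G : V →ₗ[ℝ] ι → Matrix (Fin 3) (Fin 2) ℝ)
    (Λ : V →ₗ[ℝ] ℝ) (τ : ℝ) (y y' : V) (μ : ι → Matrix (Fin 3) (Fin 2) ℝ)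
    (γ : ι → Matrix (Fin 2) (Fin 2) ℝ) : Prop where
  mem : ∀ i, G y i ∈ Stiefel
  mem' : ∀ i, G y' i ∈ Stiefel
  symm : ∀ i, (γ i)ᵀ = γ i
  momentum : ∀ w, inner ℝ y' w + ∑ i, ω i * frob (μ i) (G w i)
    + ∑ i, ω i * frob (γ i) ((G y i)ᵀ * G w i + (G w i)ᵀ * G y i) = Λ w
  update : ∀ i, G y' i = stiefelExp (G y i) (τ • μ i)
  tangent : ∀ i, (G y i)ᵀ * μ i + (μ i)ᵀ * G y i = 0

theorem exists_norm_map_le {E F : Type*} [NormedAddCommGroup E] [NormedSpace ℝ E]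
    [FiniteDimensional ℝ E] [NormedAddCommGroup F] [NormedSpace ℝ F] (f : E →ₗ[ℝ] F) :
    ∃ K : ℝ, 0 ≤ K ∧ ∀ x, ‖f x‖ ≤ K * ‖x‖ :=
  ⟨_, norm_nonneg _, (LinearMap.toContinuousLinearMap f).le_opNorm⟩

/-- The multipliers of a proximal step are bounded, uniformly in the previous iterate: `μ + U γ`
can be tested with a lift of itself, and `y'` with itself, the gradients at the barycenters being
bounded by the constraint. -/
theorem exists_multiplier_bound (ω : ι → ℝ) (hω : ∀ i, 0 < ω i)
    (G : V →ₗ[ℝ] ι → Matrix (Fin 3) (Fin 2) ℝ) (Λ : V →ₗ[ℝ] ℝ)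
    (W : (ι → Matrix (Fin 3) (Fin 2) ℝ) →ₗ[ℝ] V) (hW : ∀ m, G (W m) = m) :
    ∃ M : ℝ, 0 < M ∧ ∀ τ y y' μ γ, IsAbstractStep ω G Λ τ y y' μ γ →
      ∀ i, ‖μ i‖ ≤ M ∧ ‖γ i‖ ≤ M := by
  obtain ⟨L, hL0, hΛ⟩ := exists_norm_map_le Λ
  simp only [Real.norm_eq_abs] at hΛ
  obtain ⟨K, hK0, hWn⟩ := exists_norm_map_le W
  obtain ⟨ω₀, hω₀, hωle⟩ : ∃ ω₀ : ℝ, 0 < ω₀ ∧ ∀ i, ω₀ ^ 2 ≤ ω i := by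
    rcases isEmpty_or_nonempty ι with h | h
    · exact ⟨1, one_pos, fun i => h.elim i⟩
    · obtain ⟨i, hi⟩ := Finite.exists_min ω
      refine ⟨√(ω i), Real.sqrt_pos.2 (hω i), fun j => ?_⟩
      rw [Real.sq_sqrt (hω i).le]
      exact hi j
  set P := 10 * (∑ i, ω i) / ω₀ with hP
  have hP0 : 0 ≤ P := by
    have : 0 ≤ ∑ i, ω i := Finset.sum_nonneg fun i _ => (hω i).le
    positivity
  set k := 2 * K / ω₀ with hk
  have hk0 : 0 ≤ k := by positivity
  set N₀ := (L + P * k) + P * (k * L) + 1 with hN₀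
  refine ⟨k * (L + N₀) / ω₀ + 1, by positivity, fun τ y y' μ γ hs => ?_⟩
  set q := ∑ i, ω i * (‖μ i‖ ^ 2 + 2 * ‖γ i‖ ^ 2) with hq
  have hterm : ∀ i, 0 ≤ ω i * (‖μ i‖ ^ 2 + 2 * ‖γ i‖ ^ 2) :=
    fun i => mul_nonneg (hω i).le (by positivity)
  have hq0 : 0 ≤ q := Finset.sum_nonneg fun i _ => hterm i
  have hcell : ∀ i, ‖μ i‖ ^ 2 + 2 * ‖γ i‖ ^ 2 ≤ (√q / ω₀) ^ 2 := by
    intro i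
    rw [div_pow, Real.sq_sqrt hq0, le_div_iff₀ (by positivity), mul_comm]
    refine le_trans ?_ (Finset.single_le_sum (fun j _ => hterm j) (Finset.mem_univ i))
    exact mul_le_mul_of_nonneg_right (hωle i) (by positivity)
  have hs0 : 0 ≤ √q / ω₀ := by positivity
  have hμ : ∀ i, ‖μ i‖ ≤ √q / ω₀ := fun i =>
    le_of_sq_le_sq (by nlinarith [hcell i, sq_nonneg ‖γ i‖]) hs0
  have hγ : ∀ i, ‖γ i‖ ≤ √q / ω₀ := fun i =>
    le_of_sq_le_sq (by nlinarith [hcell i, sq_nonneg ‖μ i‖, sq_nonneg ‖γ i‖]) hs0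
  -- Testing with a lift of `μ + U γ` bounds the multipliers by `y'`.
  have hbound : √q ≤ k * (L + ‖y'‖) := by
    set m : ι → Matrix (Fin 3) (Fin 2) ℝ := fun i => μ i + G y i * γ i with hm
    have hmn : ‖m‖ ≤ 2 * (√q / ω₀) := by
      refine (pi_norm_le_iff_of_nonneg (by positivity)).2 fun i => ?_
      refine le_of_sq_le_sq ?_ (by positivity)
      have h1 : ‖m i‖ ≤ ‖μ i‖ + 2 * ‖γ i‖ :=
        (norm_add_le _ _).trans (add_le_add_right ((Matrix.frobenius_norm_mul _ _).trans
          (mul_le_mul_of_nonneg_right (norm_le_of_mem_stiefel (hs.mem i)) (norm_nonneg _))) _)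
      have h2 : ‖m i‖ ^ 2 ≤ (‖μ i‖ + 2 * ‖γ i‖) ^ 2 := by gcongr
      nlinarith [hcell i, sq_nonneg (‖μ i‖ - ‖γ i‖), sq_nonneg ‖μ i‖, sq_nonneg ‖γ i‖]
    have hw : ‖W m‖ ≤ k * √q := by
      refine (hWn m).trans ((mul_le_mul_of_nonneg_left hmn hK0).trans (le_of_eq ?_))
      rw [hk]; ring
    have h1 := hs.momentum (W m)
    rw [hW, add_assoc, ← Finset.sum_add_distrib] at h1
    have h2 : ∑ i, (ω i * frob (μ i) (m i)
        + ω i * frob (γ i) ((G y i)ᵀ * m i + (m i)ᵀ * G y i)) = q := by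
      refine Finset.sum_congr rfl fun i _ => ?_
      have hU : (G y i)ᵀ * G y i = 1 := hs.mem i
      have e1 : (G y i)ᵀ * m i + (m i)ᵀ * G y i = (2 : ℝ) • γ i := by
        simp only [hm, Matrix.mul_add, Matrix.transpose_add, Matrix.add_mul, Matrix.transpose_mul,
          hs.symm i]
        rw [← Matrix.mul_assoc, hU, Matrix.mul_assoc (γ i), hU, add_add_add_comm, hs.tangent i,
          two_smul]
        simp
      rw [e1, frob_smul_right, frob_self, hm, frob_add_right, frob_self,
        frob_mul_eq_zero (hs.symm i) (hs.tangent i)]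
      ring
    rw [h2] at h1
    have h3 : q ≤ (L + ‖y'‖) * (k * √q) := by
      have h4 := (le_abs_self _).trans (hΛ (W m))
      have h5 := (abs_le.1 (abs_real_inner_le_norm y' (W m))).1
      have h6 : (L + ‖y'‖) * ‖W m‖ ≤ (L + ‖y'‖) * (k * √q) := by gcongr
      nlinarith
    by_contra! hlt
    have hqpos : 0 < √q := lt_of_le_of_lt (by positivity) hlt
    have := mul_lt_mul_of_pos_right hlt hqpos
    rw [Real.mul_self_sqrt hq0] at this
    linarith
  -- Testing with `y'` bounds `y'` itself.
  have hN : ‖y'‖ ≤ N₀ := by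
    have h1 := hs.momentum y'
    have h2 : |∑ i, ω i * frob (μ i) (G y' i)
        + ∑ i, ω i * frob (γ i) ((G y i)ᵀ * G y' i + (G y' i)ᵀ * G y i)| ≤ P * √q := by
      rw [← Finset.sum_add_distrib]
      refine (Finset.abs_sum_le_sum_abs _ _).trans ?_
      have : P * √q = ∑ i, ω i * (10 * (√q / ω₀)) := by
        rw [← Finset.sum_mul, hP]; ring
      rw [this]
      refine Finset.sum_le_sum fun i _ => ?_
      rw [← mul_add, abs_mul, abs_of_pos (hω i)]
      refine mul_le_mul_of_nonneg_left ((abs_add_le _ _).trans ?_) (hω i).le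
      have hU := norm_le_of_mem_stiefel (hs.mem i)
      have hU' := norm_le_of_mem_stiefel (hs.mem' i)
      have e1 : |frob (μ i) (G y' i)| ≤ √q / ω₀ * 2 :=
        (abs_frob_le _ _).trans (mul_le_mul (hμ i) hU' (norm_nonneg _) hs0)
      have e2 : ‖(G y i)ᵀ * G y' i + (G y' i)ᵀ * G y i‖ ≤ 2 * 2 + 2 * 2 := by
        refine (norm_add_le _ _).trans (add_le_add ?_ ?_) <;>
        refine (Matrix.frobenius_norm_mul _ _).trans ?_ <;>
        rw [Matrix.frobenius_norm_transpose] <;> gcongr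
      have e3 : |frob (γ i) ((G y i)ᵀ * G y' i + (G y' i)ᵀ * G y i)| ≤ √q / ω₀ * (2 * 2 + 2 * 2) :=
        (abs_frob_le _ _).trans (mul_le_mul (hγ i) e2 (norm_nonneg _) hs0)
      linarith
    rw [real_inner_self_eq_norm_sq, add_assoc] at h1
    have h3 := (abs_le.1 h2).1
    have h4 := (le_abs_self _).trans (hΛ y')
    have h5 : P * √q ≤ P * (k * (L + ‖y'‖)) := by gcongr
    have h6 : ‖y'‖ ^ 2 ≤ (L + P * k) * ‖y'‖ + P * (k * L) := by nlinarith
    by_contra! hlt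
    have hb : 0 ≤ L + P * k := by positivity
    have hc : 0 ≤ P * (k * L) := by positivity
    nlinarith
  have hfin : √q / ω₀ ≤ k * (L + N₀) / ω₀ + 1 := by
    have : √q / ω₀ ≤ k * (L + N₀) / ω₀ := by
      gcongr
      exact hbound.trans (by gcongr)
    linarith
  exact fun i => ⟨(hμ i).trans hfin, (hγ i).trans hfin⟩

/-- Energy dissipation for the abstract proximal system: the multiplier terms in the energy
difference are nonpositive for small steps, as the update moves along `μ` to first order. -/
theorem exists_step_energy_lt (ω : ι → ℝ) (hω : ∀ i, 0 < ω i)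
    (G : V →ₗ[ℝ] ι → Matrix (Fin 3) (Fin 2) ℝ) (Λ : V →ₗ[ℝ] ℝ)
    (W : (ι → Matrix (Fin 3) (Fin 2) ℝ) →ₗ[ℝ] V) (hW : ∀ m, G (W m) = m) :
    ∃ τ₀ : ℝ, 0 < τ₀ ∧ ∀ τ, 0 < τ → τ < τ₀ → ∀ y y' μ γ, IsAbstractStep ω G Λ τ y y' μ γ →
      y' ≠ y → 1 / 2 * inner ℝ y' y' - Λ y' < 1 / 2 * inner ℝ y y - Λ y := by
  obtain ⟨M, hM, hbd⟩ := exists_multiplier_bound ω hω G Λ W hW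
  obtain ⟨C, δ, hC, hδ, hExp⟩ := exists_norm_stiefelExp_sub_le
  refine ⟨min (δ / M) (1 / (C * M + M * (1 + C * δ) ^ 2)), by positivity,
    fun τ hτ hτ₀ y y' μ γ hs hne => ?_⟩
  have hτ1 : τ * M < δ := (lt_div_iff₀ hM).1 (hτ₀.trans_le (min_le_left _ _))
  have hτ2 : τ * (C * M + M * (1 + C * δ) ^ 2) < 1 :=
    (lt_div_iff₀ (by positivity)).1 (hτ₀.trans_le (min_le_right _ _))
  set d := y' - y with hd
  have hmom := hs.momentum d
  have hcell : ∀ i, 0 ≤ ω i * frob (μ i) (G d i)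
      + ω i * frob (γ i) ((G y i)ᵀ * G d i + (G d i)ᵀ * G y i) := by
    intro i
    rw [← mul_add]
    refine mul_nonneg (hω i).le ?_
    obtain ⟨hμ, hγ⟩ := hbd τ y y' μ γ hs i
    have hμ0 := norm_nonneg (μ i)
    set D := G d i with hD
    have hGD : G y' i = G y i + D := by rw [hD, hd, map_sub]; simp
    -- The constraint at both iterates turns the normal part into a quadratic term.
    have hquad : (G y i)ᵀ * D + Dᵀ * G y i = -(Dᵀ * D) := by
      have h1 : (G y i)ᵀ * G y i = 1 := hs.mem i
      have h2 : (G y' i)ᵀ * G y' i = 1 := hs.mem' i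
      rw [hGD, Matrix.transpose_add, Matrix.add_mul, Matrix.mul_add, Matrix.mul_add, h1] at h2
      rw [eq_neg_iff_add_eq_zero]
      have h3 := sub_eq_zero.2 h2
      rw [← h3]
      abel
    have hnorm : ‖τ • μ i‖ = τ * ‖μ i‖ := by rw [norm_smul, Real.norm_of_nonneg hτ.le]
    have hτμ : τ * ‖μ i‖ ≤ δ := by nlinarith
    obtain ⟨R, hR⟩ : ∃ R, R = D - τ • μ i := ⟨_, rfl⟩
    have hRn : ‖R‖ ≤ C * (τ * ‖μ i‖) ^ 2 := by
      have h1 := hExp (G y i) (hs.mem i) (τ • μ i) (by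
        rw [Matrix.transpose_smul, Matrix.mul_smul, Matrix.smul_mul, ← smul_add, hs.tangent i,
          smul_zero]) (by rwa [hnorm])
      rw [← hs.update i, hnorm, hGD, add_sub_cancel_left, ← hR] at h1
      exact h1
    have hDR : D = τ • μ i + R := by rw [hR]; abel
    have hDn : ‖D‖ ≤ τ * ‖μ i‖ * (1 + C * δ) := by
      rw [hDR]
      refine (norm_add_le _ _).trans ?_
      rw [hnorm]
      have : (τ * ‖μ i‖) * (τ * ‖μ i‖) ≤ (τ * ‖μ i‖) * δ := by gcongr
      nlinarith
    have f1 : frob (μ i) D = τ * ‖μ i‖ ^ 2 + frob (μ i) R := by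
      rw [hDR, frob_add_right, frob_smul_right, frob_self]
    have f2 : |frob (μ i) R| ≤ M * (C * (τ * ‖μ i‖) ^ 2) :=
      (abs_frob_le _ _).trans (by gcongr)
    have f3 : |frob (γ i) (-(Dᵀ * D))| ≤ M * (τ * ‖μ i‖ * (1 + C * δ)) ^ 2 := by
      refine (abs_frob_le _ _).trans ?_
      rw [norm_neg, pow_two]
      refine mul_le_mul hγ ((Matrix.frobenius_norm_mul _ _).trans ?_) (norm_nonneg _) hM.le
      rw [Matrix.frobenius_norm_transpose]
      gcongr
    rw [hquad, f1]
    have g2 := (abs_le.1 f2).1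
    have g3 := (abs_le.1 f3).1
    have g4 : τ * (C * M + M * (1 + C * δ) ^ 2) * (τ * ‖μ i‖ ^ 2) ≤ 1 * (τ * ‖μ i‖ ^ 2) :=
      mul_le_mul_of_nonneg_right hτ2.le (by positivity)
    nlinarith
  have hsum := Finset.sum_nonneg fun i (_ : i ∈ Finset.univ) => hcell i
  rw [Finset.sum_add_distrib] at hsum
  have hdpos : 0 < inner ℝ d d := real_inner_self_pos.2 (sub_ne_zero.2 hne)
  have hy : y = y' - d := by rw [hd]; abel
  have hyy : inner ℝ y y = inner ℝ y' y' - 2 * inner ℝ y' d + inner ℝ d d := by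
    rw [hy, real_inner_sub_sub_self]
  have hΛd : Λ d = Λ y' - Λ y := by rw [hd, map_sub]
  rw [hyy]
  linarith

end Abstract

end Frobenius

/-! ### Integration over cells and edges -/

section Integrals

open MeasureTheory Filter Topology

variable {Ω : Set Plane} {𝒯 : Triangulation Ω}

theorem hausdorffMeasure_edge {p q : Plane} :
    Measure.hausdorffMeasure 1 (convexHull ℝ (({p, q} : Finset Plane) : Set Plane))
      = edist p q := by
  rw [Finset.coe_pair, convexHull_pair, hausdorffMeasure_segment]

theorem hausdorffMeasure_edge_ne_top {e : Finset Plane} (he : e.card = 2) :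
    Measure.hausdorffMeasure 1 (convexHull ℝ (e : Set Plane)) ≠ ⊤ := by
  obtain ⟨p, q, -, rfl⟩ := Finset.card_eq_two.1 he
  rw [hausdorffMeasure_edge]
  exact edist_ne_top p q

theorem integrableOn_dotProduct {m : Measure Plane} {K : Set Plane} (hK : IsCompact K)
    {g f : Plane → Fin 3 → ℝ} (hg : IntegrableOn g K m) (hf : Continuous f) :
    IntegrableOn (fun x => g x ⬝ᵥ f x) K m := by
  simp only [dotProduct]
  refine integrable_finsetSum _ fun i _ => ?_
  exact IntegrableOn.mul_continuousOn (Integrable.eval hg i)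
    ((continuous_apply i).comp hf).continuousOn hK

theorem integrableOn_of_continuous {A : Type*} [NormedAddCommGroup A] [NormedSpace ℝ A]
    {m : Measure Plane} {K : Set Plane} (hK : IsCompact K)
    (hm : m K ≠ ⊤) {f : Plane → A} (hf : Continuous f) : IntegrableOn f K m := by
  have h1 : IntegrableOn (fun _ => (1 : ℝ)) K m := integrableOn_const hm
  simpa using h1.smul_continuousOn hf.continuousOn hK

theorem integrableOn_edge {A : Type*} [NormedAddCommGroup A] [NormedSpace ℝ A]
    {e : Finset Plane} (he : e.card = 2) {f : Plane → A}
    (hf : Continuous f) :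
    IntegrableOn f (convexHull ℝ (e : Set Plane)) (Measure.hausdorffMeasure 1) :=
  integrableOn_of_continuous (isCompact_convexHull_finset e) (hausdorffMeasure_edge_ne_top he) hf

/-- A nonnegative continuous function with vanishing integral over an edge vanishes on it. -/
theorem eq_zero_of_edge_integral_eq_zero {e : Finset Plane} (he : e.card = 2) {g : Plane → ℝ}
    (hg : Continuous g) (h0 : ∀ x, 0 ≤ g x)
    (hint : ∫ x in convexHull ℝ (e : Set Plane), g x ∂(Measure.hausdorffMeasure 1) = 0)
    {x : Plane} (hx : x ∈ convexHull ℝ (e : Set Plane)) : g x = 0 := by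
  rw [setIntegral_eq_zero_iff_of_nonneg_ae (Eventually.of_forall h0) (integrableOn_edge he hg)]
    at hint
  by_contra hne
  obtain ⟨ε, hε, hball⟩ := Metric.isOpen_iff.1 (isOpen_ne_fun hg continuous_const) x hne
  obtain ⟨r, hre, hrx⟩ : ∃ r ∈ e, r ≠ x := by
    obtain ⟨p, q, hpq, rfl⟩ := Finset.card_eq_two.1 he
    by_cases h : p = x
    · exact ⟨q, by simp, fun h' => hpq (h.trans h'.symm)⟩
    · exact ⟨p, by simp, h⟩
  have hlim : Tendsto (fun t : ℝ => AffineMap.lineMap x r t) (𝓝[>] 0) (𝓝 x) := by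
    have hc : Continuous fun t : ℝ => (AffineMap.lineMap x r t : Plane) :=
      AffineMap.lineMap_continuous
    simpa using (hc.tendsto 0).mono_left nhdsWithin_le_nhds
  obtain ⟨t, ⟨htb, ht1⟩, ht0⟩ := (((hlim.eventually (Metric.ball_mem_nhds x hε)).and
    (mem_nhdsWithin_of_mem_nhds (Iio_mem_nhds one_pos))).and self_mem_nhdsWithin).exists
  have ht0' : 0 < t := ht0
  have ht1' : t < 1 := ht1
  have hr : r ∈ convexHull ℝ (e : Set Plane) := subset_convexHull ℝ _ hre
  have hseg : segment ℝ x (AffineMap.lineMap x r t) ⊆ convexHull ℝ (e : Set Plane) :=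
    (convex_convexHull ℝ _).segment_subset hx
      ((convex_convexHull ℝ _).lineMap_mem hx hr ⟨ht0'.le, ht1'.le⟩)
  have hseg' : segment ℝ x (AffineMap.lineMap x r t) ⊆ {z | g z ≠ 0} :=
    ((convex_ball x ε).segment_subset (Metric.mem_ball_self hε) htb).trans hball
  have hz : Measure.hausdorffMeasure 1 (segment ℝ x (AffineMap.lineMap x r t)) = 0 := by
    rw [Filter.EventuallyEq, ae_iff] at hint
    exact measure_mono_null (Set.subset_inter hseg' hseg)
      (Measure.measure_inter_eq_zero_of_restrict (t := {z | g z ≠ 0}) hint)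
  rw [hausdorffMeasure_segment, edist_eq_zero] at hz
  have : dist x (AffineMap.lineMap x r t) = t * dist x r := by
    rw [dist_left_lineMap, Real.norm_of_nonneg ht0'.le]
  rw [← hz, dist_self] at this
  have h2 : 0 < t * dist x r := mul_pos ht0' (dist_pos.2 hrx.symm)
  linarith

theorem volume_cell_pos (T : 𝒯.Cell) : 0 < volume.real (convexHull ℝ (T.1 : Set Plane)) := by
  refine ENNReal.toReal_pos ?_ (isCompact_convexHull_finset _).measure_lt_top.ne
  exact (Measure.measure_pos_of_nonempty_interior _
    (interior_convexHull_nonempty (cell_card T) (cell_indep T))).ne'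

theorem cellIntegral_add {f g : 𝒯.Cell → Plane → ℝ}
    (hf : ∀ T, IntegrableOn (f T) (convexHull ℝ (T.1 : Set Plane)))
    (hg : ∀ T, IntegrableOn (g T) (convexHull ℝ (T.1 : Set Plane))) :
    𝒯.cellIntegral (fun T x => f T x + g T x) = 𝒯.cellIntegral f + 𝒯.cellIntegral g := by
  simp only [cellIntegral, ← Finset.sum_add_distrib]
  exact Finset.sum_congr rfl fun T _ => integral_add (hf T) (hg T)

theorem cellIntegral_const_mul (c : ℝ) (f : 𝒯.Cell → Plane → ℝ) :
    𝒯.cellIntegral (fun T x => c * f T x) = c * 𝒯.cellIntegral f := by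
  simp only [cellIntegral, integral_const_mul, Finset.mul_sum]

theorem edgeIntegral_add {E : Finset (Finset Plane)} {f g : Finset Plane → Plane → ℝ}
    (hf : ∀ e ∈ E, IntegrableOn (f e) (convexHull ℝ (e : Set Plane)) (Measure.hausdorffMeasure 1))
    (hg : ∀ e ∈ E, IntegrableOn (g e) (convexHull ℝ (e : Set Plane))
      (Measure.hausdorffMeasure 1)) :
    edgeIntegral E (fun e x => f e x + g e x) = edgeIntegral E f + edgeIntegral E g := by
  simp only [edgeIntegral, ← Finset.sum_add_distrib]
  exact Finset.sum_congr rfl fun e he => integral_add (hf e he) (hg e he)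

theorem edgeIntegral_const_mul (E : Finset (Finset Plane)) (c : ℝ)
    (f : Finset Plane → Plane → ℝ) :
    edgeIntegral E (fun e x => c * f e x) = c * edgeIntegral E f := by
  simp only [edgeIntegral, integral_const_mul, Finset.mul_sum]

/-! ### Jumps and averages as linear maps -/

variable (𝒯) in
/-- The jump `[y]` as a linear map. -/
def jumpValL (n : Finset Plane → Plane) : 𝒯.Vh →ₗ[ℝ] Finset Plane → Plane → Fin 3 → ℝ where
  toFun y := jumpVal n y
  map_add' y w := by
    funext e x
    simp only [jumpVal, jump, traceMinus, tracePlus, val_add, Finset.sum_add_distrib, Pi.add_apply]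
    abel
  map_smul' c y := by
    funext e x
    simp only [jumpVal, jump, traceMinus, tracePlus, val_smul, ← Finset.smul_sum, Pi.smul_apply,
      ← smul_sub, RingHom.id_apply]

variable (𝒯) in
/-- The jump `[∇_h y]` as a linear map. -/
def jumpGradL (n : Finset Plane → Plane) : 𝒯.Vh →ₗ[ℝ] Finset Plane → Plane → Fin 3 → ℝ where
  toFun y := jumpGrad n y
  map_add' y w := by
    funext e x
    simp only [jumpGrad, jump, traceMinus, tracePlus, grad_add, Finset.sum_add_distrib,
      Pi.add_apply, ← Matrix.add_mulVec]
    congr 1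
    abel
  map_smul' c y := by
    funext e x
    simp only [jumpGrad, jump, traceMinus, tracePlus, grad_smul, ← Finset.smul_sum, Pi.smul_apply,
      ← smul_sub, RingHom.id_apply, Matrix.smul_mulVec]

/-- The normal-normal component of a triple of matrices, as a linear map. -/
def normalComp (v : Plane) (i : Fin 3) : (Fin 3 → Matrix (Fin 2) (Fin 2) ℝ) →ₗ[ℝ] ℝ where
  toFun H := (H i *ᵥ v.ofLp) ⬝ᵥ v.ofLp
  map_add' H H' := by simp only [Pi.add_apply, Matrix.add_mulVec, add_dotProduct]
  map_smul' c H := by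
    simp only [Pi.smul_apply, Matrix.smul_mulVec, smul_dotProduct, RingHom.id_apply]

theorem avgHess_eq_average (n : Finset Plane → Plane) (y : 𝒯.Vh) (e : Finset Plane) (x : Plane)
    (i : Fin 3) :
    avgHess n y e x i = 𝒯.average n e fun T => normalComp (n e) i (hess y T x) := by
  change normalComp (n e) i (𝒯.average n e fun T => hess y T x) = _
  simp only [Triangulation.average, traceMinus, tracePlus]
  split_ifs
  · rw [map_smul, map_add, map_sum, map_sum]
  · rw [map_sum]

variable (𝒯) in
/-- The average `({∇²_h y} n) n` as a linear map. -/
def avgHessL (n : Finset Plane → Plane) : 𝒯.Vh →ₗ[ℝ] Finset Plane → Plane → Fin 3 → ℝ where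
  toFun y := avgHess n y
  map_add' y w := by
    funext e x i
    simp only [avgHess_eq_average, Triangulation.average, traceMinus, tracePlus, hess_add, map_add,
      Finset.sum_add_distrib, Pi.add_apply]
    split_ifs
    · simp only [smul_eq_mul]; ring
    · rfl
  map_smul' c y := by
    funext e x i
    simp only [avgHess_eq_average, Triangulation.average, traceMinus, tracePlus, hess_smul,
      map_smul, Pi.smul_apply, RingHom.id_apply, smul_eq_mul, ← Finset.mul_sum]
    split_ifs
    · ring
    · rfl

theorem continuous_jumpVal (n : Finset Plane → Plane) (y : 𝒯.Vh) (e : Finset Plane) :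
    Continuous (jumpVal n y e) :=
  (continuous_finsetSum _ fun T _ => continuous_val y T).sub
    (continuous_finsetSum _ fun T _ => continuous_val y T)

theorem continuous_jumpGrad (n : Finset Plane → Plane) (y : 𝒯.Vh) (e : Finset Plane) :
    Continuous (jumpGrad n y e) :=
  ((continuous_finsetSum _ fun T _ => continuous_grad y T).sub
    (continuous_finsetSum _ fun T _ => continuous_grad y T)).matrix_mulVec continuous_const

theorem avgHess_eq (n : Finset Plane → Plane) (y : 𝒯.Vh) (e : Finset Plane) (x c : Plane) :
    avgHess n y e x = avgHess n y e c := by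
  have e : (fun T => hess y T x) = fun T => hess y T c := funext fun T => hess_eq y T x c
  funext i
  rw [avgHess, e]
  rfl

theorem continuous_avgHess (n : Finset Plane → Plane) (y : 𝒯.Vh) (e : Finset Plane) :
    Continuous (avgHess n y e) := by
  rw [show avgHess n y e = fun _ => avgHess n y e 0 from funext fun x => avgHess_eq n y e x 0]
  exact continuous_const

/-! ### The forms of the scheme as (bi)linear maps -/

/-- The linear form `w ↦ c ∫_E g · B w`. -/
def edgeFunctional {E : Finset (Finset Plane)} (c : ℝ)
    (g : Finset Plane → Plane → Fin 3 → ℝ)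
    (hg : ∀ e ∈ E, IntegrableOn (g e) (convexHull ℝ (e : Set Plane)) (Measure.hausdorffMeasure 1))
    (B : 𝒯.Vh →ₗ[ℝ] Finset Plane → Plane → Fin 3 → ℝ) (hB : ∀ y e, Continuous (B y e)) :
    𝒯.Vh →ₗ[ℝ] ℝ where
  toFun w := edgeIntegral E fun e x => c * (g e x ⬝ᵥ B w e x)
  map_add' y w := by
    simp only [map_add, Pi.add_apply, dotProduct_add, edgeIntegral_const_mul]
    rw [edgeIntegral_add, mul_add] <;>
    exact fun e he => integrableOn_dotProduct (isCompact_convexHull_finset e) (hg e he) (hB _ e)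
  map_smul' r w := by
    simp only [map_smul, Pi.smul_apply, dotProduct_smul, smul_eq_mul, edgeIntegral_const_mul,
      RingHom.id_apply]
    ring

/-- The bilinear form `(y, w) ↦ c ∫_E A y · B w`. -/
def edgeForm {E : Finset (Finset Plane)} (hE : ∀ e ∈ E, e.card = 2) (c : ℝ)
    (A B : 𝒯.Vh →ₗ[ℝ] Finset Plane → Plane → Fin 3 → ℝ) (hA : ∀ y e, Continuous (A y e))
    (hB : ∀ y e, Continuous (B y e)) : 𝒯.Vh →ₗ[ℝ] 𝒯.Vh →ₗ[ℝ] ℝ where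
  toFun y := edgeFunctional c (A y) (fun e he => integrableOn_edge (hE e he) (hA y e)) B hB
  map_add' y z := by
    refine LinearMap.ext fun w => ?_
    change edgeIntegral E _ = edgeIntegral E _ + edgeIntegral E _
    simp only [map_add, Pi.add_apply, add_dotProduct, edgeIntegral_const_mul]
    rw [edgeIntegral_add, mul_add] <;>
    exact fun e he => integrableOn_dotProduct (isCompact_convexHull_finset e)
      (integrableOn_edge (hE e he) (hA _ e)) (hB _ e)
  map_smul' r y := by
    refine LinearMap.ext fun w => ?_
    change edgeIntegral E _ = r * edgeIntegral E _
    simp only [map_smul, Pi.smul_apply, smul_dotProduct, smul_eq_mul, edgeIntegral_const_mul]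
    ring

theorem frob_add_left {m n : Type*} [Fintype m] [Fintype n] (A B C : Matrix m n ℝ) :
    frob (A + B) C = frob A C + frob B C := by
  simp [frob, add_mul, Finset.sum_add_distrib]

theorem frob_smul_left {m n : Type*} [Fintype m] [Fintype n] (A B : Matrix m n ℝ) (c : ℝ) :
    frob (c • A) B = c * frob A B := by
  simp [frob, Finset.mul_sum, mul_assoc]

theorem frob_comm {m n : Type*} [Fintype m] [Fintype n] (A B : Matrix m n ℝ) :
    frob A B = frob B A := by
  simp only [frob, mul_comm]

theorem integrableOn_frob_hess (y w : 𝒯.Vh) (T : 𝒯.Cell) :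
    IntegrableOn (fun x => ∑ i, frob (hess y T x i) (hess w T x i))
      (convexHull ℝ (T.1 : Set Plane)) := by
  simp only [fun x => hess_eq y T x 0, fun x => hess_eq w T x 0]
  exact integrableOn_const (isCompact_convexHull_finset _).measure_lt_top.ne

variable (𝒯) in
/-- The bilinear form `(y, w) ↦ ∫_Ω ∇²_h y : ∇²_h w`. -/
def hessForm : 𝒯.Vh →ₗ[ℝ] 𝒯.Vh →ₗ[ℝ] ℝ :=
  LinearMap.mk₂ ℝ
    (fun y w => 𝒯.cellIntegral fun T x => ∑ i, frob (hess y T x i) (hess w T x i))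
    (fun y z w => by
      rw [← cellIntegral_add (integrableOn_frob_hess y w) (integrableOn_frob_hess z w)]
      simp only [hess_add, Pi.add_apply, frob_add_left, Finset.sum_add_distrib])
    (fun c y w => by
      rw [smul_eq_mul, ← cellIntegral_const_mul]
      simp only [hess_smul, Pi.smul_apply, frob_smul_left, Finset.mul_sum])
    (fun y z w => by
      rw [← cellIntegral_add (integrableOn_frob_hess y z) (integrableOn_frob_hess y w)]
      simp only [hess_add, Pi.add_apply, frob_add_right, Finset.sum_add_distrib])
    (fun c y w => by
      rw [smul_eq_mul, ← cellIntegral_const_mul]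
      simp only [hess_smul, Pi.smul_apply, frob_smul_right, Finset.mul_sum])

theorem card_activeEdge (ΓD : Set Plane) :
    ∀ e ∈ 𝒯.interiorEdges ∪ 𝒯.boundaryEdges ΓD, e.card = 2 := by
  intro e he
  simp only [interiorEdges, boundaryEdges, Finset.mem_union, Finset.mem_filter] at he
  rcases he with he | he <;> exact (mem_edges.1 he.1).2

theorem card_boundaryEdge (ΓD : Set Plane) : ∀ e ∈ 𝒯.boundaryEdges ΓD, e.card = 2 :=
  fun e he => card_activeEdge ΓD e (Finset.mem_union_right _ he)

variable (𝒯) in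
/-- The interior penalty form as a bilinear map. -/
def ahForm (ΓD : Set Plane) (n : Finset Plane → Plane) (h η₀ η₁ : ℝ) :
    𝒯.Vh →ₗ[ℝ] 𝒯.Vh →ₗ[ℝ] ℝ :=
  let C := edgeForm (card_activeEdge (𝒯 := 𝒯) ΓD) 1 (jumpGradL 𝒯 n) (avgHessL 𝒯 n)
    (continuous_jumpGrad n) (continuous_avgHess n)
  hessForm 𝒯 - C - C.flip
    + η₁ • edgeForm (card_activeEdge (𝒯 := 𝒯) ΓD) h⁻¹ (jumpGradL 𝒯 n) (jumpGradL 𝒯 n)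
      (continuous_jumpGrad n) (continuous_jumpGrad n)
    + η₀ • edgeForm (card_activeEdge (𝒯 := 𝒯) ΓD) (h ^ 3)⁻¹ (jumpValL 𝒯 n) (jumpValL 𝒯 n)
      (continuous_jumpVal n) (continuous_jumpVal n)

theorem ahForm_apply (ΓD : Set Plane) (n : Finset Plane → Plane) (h η₀ η₁ : ℝ) (y w : 𝒯.Vh) :
    ahForm 𝒯 ΓD n h η₀ η₁ y w = ah ΓD n h η₀ η₁ y w := by
  have e : ∀ y w : 𝒯.Vh, edgeIntegral (𝒯.interiorEdges ∪ 𝒯.boundaryEdges ΓD)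
      (fun e x => jumpGrad n y e x ⬝ᵥ avgHess n w e x)
      = edgeIntegral (𝒯.interiorEdges ∪ 𝒯.boundaryEdges ΓD)
      (fun e x => 1 * (jumpGrad n y e x ⬝ᵥ avgHess n w e x)) := by simp
  rw [ah, e, e]
  rfl

theorem ah_comm (ΓD : Set Plane) (n : Finset Plane → Plane) (h η₀ η₁ : ℝ) (y w : 𝒯.Vh) :
    ah ΓD n h η₀ η₁ y w = ah ΓD n h η₀ η₁ w y := by
  simp only [ah, fun e x => dotProduct_comm (jumpVal n y e x) (jumpVal n w e x),
    fun e x => dotProduct_comm (jumpGrad n y e x) (jumpGrad n w e x),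
    fun T x i => frob_comm (hess y T x i) (hess w T x i)]
  ring

/-- An `L²` function on `Ω` is integrable over each triangle, as the boundary of a triangle is a
null set. -/
theorem integrableOn_cell (hreg : interior (closure Ω) = Ω) {f : Plane → Fin 3 → ℝ}
    (hf : MemLp f 2 (volume.restrict Ω)) (T : 𝒯.Cell) :
    IntegrableOn f (convexHull ℝ (T.1 : Set Plane)) := by
  have hcvx : Convex ℝ (convexHull ℝ (T.1 : Set Plane)) := convex_convexHull ℝ _
  have hae : (interior (convexHull ℝ (T.1 : Set Plane)) : Set Plane)
      =ᵐ[volume] convexHull ℝ (T.1 : Set Plane) :=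
    interior_ae_eq_of_null_frontier (hcvx.addHaar_frontier volume)
  refine IntegrableOn.congr_set_ae ?_ hae.symm
  have hsub : interior (convexHull ℝ (T.1 : Set Plane)) ⊆ Ω := by
    exact (interior_mono (cell_subset_closure T)).trans hreg.subset
  have : IsFiniteMeasure (volume.restrict (interior (convexHull ℝ (T.1 : Set Plane)))) :=
    isFiniteMeasure_restrict.2 ((measure_mono interior_subset).trans_lt
      (isCompact_convexHull_finset _).measure_lt_top).ne
  exact (hf.mono_measure (Measure.restrict_mono_set _ hsub)).integrable one_le_two

theorem integrableOn_boundaryEdge {ΓD : Set Plane} {g : Plane → Fin 3 → ℝ}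
    (hg : MemLp g 2 ((Measure.hausdorffMeasure 1).restrict ΓD)) {e : Finset Plane}
    (he : e ∈ 𝒯.boundaryEdges ΓD) :
    IntegrableOn g (convexHull ℝ (e : Set Plane)) (Measure.hausdorffMeasure 1) := by
  have hcard := card_boundaryEdge ΓD e he
  simp only [boundaryEdges, Finset.mem_filter] at he
  have : NullSingletonClass (Measure.hausdorffMeasure 1 : Measure Plane) :=
    Measure.nullSingletonClass_hausdorff _ one_pos
  have hae : openEdge e =ᵐ[Measure.hausdorffMeasure 1] convexHull ℝ (e : Set Plane) :=
    sdiff_null_ae_eq_self (e.finite_toSet.measure_zero _)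
  refine IntegrableOn.congr_set_ae ?_ hae.symm
  have : IsFiniteMeasure ((Measure.hausdorffMeasure 1).restrict (openEdge e)) :=
    isFiniteMeasure_restrict.2 ((measure_mono Set.sdiff_subset).trans_lt
      (hausdorffMeasure_edge_ne_top hcard).lt_top).ne
  exact (hg.mono_measure (Measure.restrict_mono_set _ he.2)).integrable one_le_two

/-- The data `(f, w) + F_h(w)` form a linear functional. -/
theorem exists_dataForm (hreg : interior (closure Ω) = Ω) (ΓD : Set Plane)
    (n : Finset Plane → Plane) (h η₀ η₁ : ℝ) {f yD GD : Plane → Fin 3 → ℝ}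
    (hf : MemLp f 2 (volume.restrict Ω))
    (hyD : MemLp yD 2 ((Measure.hausdorffMeasure 1).restrict ΓD))
    (hGD : MemLp GD 2 ((Measure.hausdorffMeasure 1).restrict ΓD)) :
    ∃ Λ : 𝒯.Vh →ₗ[ℝ] ℝ, ∀ w, Λ w = load f w + Fh ΓD n h η₀ η₁ yD GD w := by
  have hint : ∀ (w : 𝒯.Vh) (T : 𝒯.Cell), IntegrableOn (fun x => f x ⬝ᵥ val w T x)
      (convexHull ℝ (T.1 : Set Plane)) := fun w T =>
    integrableOn_dotProduct (isCompact_convexHull_finset _) (integrableOn_cell hreg hf T)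
      (continuous_val w T)
  let Λ₁ : 𝒯.Vh →ₗ[ℝ] ℝ :=
    { toFun := fun w => load f w
      map_add' := fun y w => by
        simp only [load]
        rw [← cellIntegral_add (hint y) (hint w)]
        simp only [val_add, dotProduct_add]
      map_smul' := fun c y => by
        simp only [load, RingHom.id_apply, smul_eq_mul]
        rw [← cellIntegral_const_mul]
        simp only [val_smul, dotProduct_smul, smul_eq_mul] }
  let F₁ := edgeFunctional (E := 𝒯.boundaryEdges ΓD) 1 (fun _ => GD)
    (fun e he => integrableOn_boundaryEdge hGD he)
    (avgHessL 𝒯 n) (continuous_avgHess n)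
  let F₂ := edgeFunctional (E := 𝒯.boundaryEdges ΓD) h⁻¹ (fun _ => GD)
    (fun e he => integrableOn_boundaryEdge hGD he)
    (jumpGradL 𝒯 n) (continuous_jumpGrad n)
  let F₃ := edgeFunctional (E := 𝒯.boundaryEdges ΓD) (h ^ 3)⁻¹ (fun _ => yD)
    (fun e he => integrableOn_boundaryEdge hyD he) (jumpValL 𝒯 n) (continuous_jumpVal n)
  refine ⟨Λ₁ + (-F₁ + η₁ • F₂ + η₀ • F₃), fun w => ?_⟩
  have e : edgeIntegral (𝒯.boundaryEdges ΓD) (fun e x => GD x ⬝ᵥ avgHess n w e x)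
      = edgeIntegral (𝒯.boundaryEdges ΓD) (fun e x => 1 * (GD x ⬝ᵥ avgHess n w e x)) := by simp
  rw [Fh, e]
  rfl

end Integrals

/-! ### Positive definiteness of the interior penalty form -/

section Positivity

open MeasureTheory Filter Topology

variable {Ω : Set Plane} {𝒯 : Triangulation Ω}

/-- Shape regularity and quasi-uniformity bound the area of the triangles from below. -/
theorem sq_le_volume_cell {h σ : ℝ} (hh : 0 < h) (hreg : 𝒯.IsRegular h σ) (T : 𝒯.Cell) :
    h ^ 2 ≤ (4 * σ ^ 4 / Real.pi) * volume.real (convexHull ℝ (T.1 : Set Plane)) := by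
  obtain ⟨-, h1, c, r, hr, hball, h2⟩ := hreg T.1 T.2
  set D := Metric.diam (convexHull ℝ (T.1 : Set Plane))
  have hvol : Real.pi * r ^ 2 ≤ volume.real (convexHull ℝ (T.1 : Set Plane)) := by
    have h3 := measureReal_mono (μ := volume) hball
      (isCompact_convexHull_finset T.1).measure_lt_top.ne
    refine le_trans (le_of_eq ?_) h3
    rw [Measure.real, EuclideanSpace.volume_closedBall_fin_two, ENNReal.toReal_mul,
      ENNReal.toReal_pow, ENNReal.toReal_ofReal hr.le]
    rw [mul_comm, ← ENNReal.toReal_ofReal Real.pi_pos.le]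
    simp [ENNReal.toReal_ofReal Real.pi_pos.le]
  have hD : 0 ≤ D := Metric.diam_nonneg
  have hσ : 0 < σ := by
    by_contra! hle
    nlinarith
  have h4 : h ≤ σ * (σ * (2 * r)) := h1.trans (by gcongr)
  have h5 : h ^ 2 ≤ (σ * (σ * (2 * r))) ^ 2 := by gcongr
  refine h5.trans ?_
  rw [div_mul_eq_mul_div, le_div_iff₀ Real.pi_pos]
  have h6 : 4 * σ ^ 4 * (Real.pi * r ^ 2)
      ≤ 4 * σ ^ 4 * volume.real (convexHull ℝ (T.1 : Set Plane)) := by gcongr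
  linarith

/-- An edge of a triangle is not longer than the diameter of the triangle. -/
theorem measureReal_edge_le {h σ : ℝ} (hreg : 𝒯.IsRegular h σ) {e : Finset Plane}
    (he : e.card = 2) {T : 𝒯.Cell} (heT : e ⊆ T.1) :
    (Measure.hausdorffMeasure 1).real (convexHull ℝ (e : Set Plane)) ≤ h := by
  obtain ⟨p, q, -, rfl⟩ := Finset.card_eq_two.1 he
  rw [Measure.real, hausdorffMeasure_edge, ← dist_edist]
  refine le_trans ?_ (hreg T.1 T.2).1
  exact Metric.dist_le_diam_of_mem (isCompact_convexHull_finset T.1).isBounded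
    (subset_convexHull ℝ _ (heT (by simp))) (subset_convexHull ℝ _ (heT (by simp)))

open Classical in
/-- The cells containing a given edge. -/
def adjacentCells (𝒯 : Triangulation Ω) (e : Finset Plane) : Finset 𝒯.Cell :=
  Finset.univ.filter fun T => e ⊆ T.1

theorem sum_sq_le_of_card_le_one {ι : Type*} {s : Finset ι} (hs : s.card ≤ 1) (q : ι → ℝ) :
    (∑ i ∈ s, q i) ^ 2 = ∑ i ∈ s, q i ^ 2 := by
  rcases Nat.le_one_iff_eq_zero_or_eq_one.1 hs with h | h
  · rw [Finset.card_eq_zero.1 h]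
    simp
  · obtain ⟨a, rfl⟩ := Finset.card_eq_one.1 h
    simp

theorem average_sq_le {n : Finset Plane → Plane} {e : Finset Plane} (he : e.card = 2)
    (hn1 : ‖n e‖ = 1) (hn : ∀ a ∈ e, ∀ b ∈ e, inner ℝ (n e) (b - a) = 0) (q : 𝒯.Cell → ℝ) :
    (𝒯.average n e q) ^ 2 ≤ ∑ T ∈ adjacentCells 𝒯 e, q T ^ 2 := by
  classical
  have hn0 : n e ≠ 0 := fun h => by simp [h] at hn1
  set M : Finset 𝒯.Cell :=
    Finset.univ.filter fun T => e ⊆ T.1 ∧ inner ℝ (n e) (bary T.1 - bary e) < 0 with hM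
  set P : Finset 𝒯.Cell :=
    Finset.univ.filter fun T => e ⊆ T.1 ∧ 0 < inner ℝ (n e) (bary T.1 - bary e) with hP
  have hM1 : M.card ≤ 1 := Finset.card_le_one.2 fun A hA B hB => by
    simp only [hM, Finset.mem_filter] at hA hB
    exact cell_eq_of_same_side he hn0 hn hA.2.1 hB.2.1 (mul_pos_of_neg_of_neg hA.2.2 hB.2.2)
  have hP1 : P.card ≤ 1 := Finset.card_le_one.2 fun A hA B hB => by
    simp only [hP, Finset.mem_filter] at hA hB
    exact cell_eq_of_same_side he hn0 hn hA.2.1 hB.2.1 (mul_pos hA.2.2 hB.2.2)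
  have hdisj : Disjoint M P := Finset.disjoint_left.2 fun A hA hB => by
    simp only [hM, hP, Finset.mem_filter] at hA hB
    exact lt_asymm hA.2.2 hB.2.2
  have hsub : M ∪ P ⊆ adjacentCells 𝒯 e := by
    intro A hA
    simp only [hM, hP, Finset.mem_union, Finset.mem_filter, adjacentCells] at hA ⊢
    exact ⟨Finset.mem_univ _, hA.elim (fun h => h.2.1) fun h => h.2.1⟩
  have key : (∑ T ∈ M, q T) ^ 2 + (∑ T ∈ P, q T) ^ 2 ≤ ∑ T ∈ adjacentCells 𝒯 e, q T ^ 2 := by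
    rw [sum_sq_le_of_card_le_one hM1, sum_sq_le_of_card_le_one hP1, ← Finset.sum_union hdisj]
    exact Finset.sum_le_sum_of_subset_of_nonneg hsub fun _ _ _ => sq_nonneg _
  refine le_trans ?_ key
  have e1 : 𝒯.traceMinus n e q = ∑ T ∈ M, q T := by
    rw [traceMinus, hM]
  have e2 : 𝒯.tracePlus n e q = ∑ T ∈ P, q T := by
    rw [tracePlus, hP]
  rw [Triangulation.average, e1, e2]
  split_ifs
  · rw [smul_eq_mul]
    nlinarith [sq_nonneg ((∑ T ∈ M, q T) - ∑ T ∈ P, q T), sq_nonneg (∑ T ∈ M, q T),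
      sq_nonneg (∑ T ∈ P, q T)]
  · nlinarith [sq_nonneg (∑ T ∈ P, q T)]

theorem normalComp_sq_le {v : Plane} (hv : ‖v‖ = 1) (i : Fin 3)
    (H : Fin 3 → Matrix (Fin 2) (Fin 2) ℝ) : normalComp v i H ^ 2 ≤ frob (H i) (H i) := by
  have hv2 : v 0 ^ 2 + v 1 ^ 2 = 1 := by
    have := EuclideanSpace.real_norm_sq_eq v
    rw [hv, Fin.sum_univ_two] at this
    linarith
  have hcs := Finset.sum_mul_sq_le_sq_mul_sq (Finset.univ : Finset (Fin 2 × Fin 2))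
    (fun p => H i p.1 p.2) fun p => v p.2 * v p.1
  have h2 : ∑ p : Fin 2 × Fin 2, (v p.2 * v p.1) ^ 2 = 1 := by
    rw [Fintype.sum_prod_type]
    simp only [Fin.sum_univ_two]
    linear_combination (v 0 ^ 2 + v 1 ^ 2 + 1) * hv2
  rw [h2, mul_one, Fintype.sum_prod_type, Fintype.sum_prod_type] at hcs
  simp only [Fin.sum_univ_two] at hcs
  simp only [normalComp, LinearMap.coe_mk, AddHom.coe_mk, Matrix.mulVec, dotProduct, frob,
    Fin.sum_univ_two]
  linarith

/-- The squared Frobenius norm of the Hessian of `y` on `T`. -/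
def hessSq (y : 𝒯.Vh) (T : 𝒯.Cell) : ℝ := ∑ i, frob (hess y T 0 i) (hess y T 0 i)

theorem hessSq_nonneg (y : 𝒯.Vh) (T : 𝒯.Cell) : 0 ≤ hessSq y T :=
  Finset.sum_nonneg fun _ _ => Finset.sum_nonneg fun _ _ => Finset.sum_nonneg fun _ _ =>
    mul_self_nonneg _

theorem hess_eq_zero_of_hessSq {y : 𝒯.Vh} {T : 𝒯.Cell} (h : hessSq y T = 0) (x : Plane) :
    hess y T x = 0 := by
  rw [hess_eq y T x 0]
  funext i
  ext j k
  have h1 := (Finset.sum_eq_zero_iff_of_nonneg fun i _ => Finset.sum_nonneg fun j _ =>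
    Finset.sum_nonneg fun k _ => mul_self_nonneg _).1 h i (Finset.mem_univ i)
  have h2 := (Finset.sum_eq_zero_iff_of_nonneg fun j _ =>
    Finset.sum_nonneg fun k _ => mul_self_nonneg _).1 h1 j (Finset.mem_univ j)
  have h3 := (Finset.sum_eq_zero_iff_of_nonneg fun k _ => mul_self_nonneg _).1 h2 k
    (Finset.mem_univ k)
  exact mul_self_eq_zero.1 h3

theorem avgHess_dot_self_le {n : Finset Plane → Plane} {e : Finset Plane} (he : e.card = 2)
    (hn1 : ‖n e‖ = 1) (hn : ∀ a ∈ e, ∀ b ∈ e, inner ℝ (n e) (b - a) = 0) (y : 𝒯.Vh) (x : Plane) :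
    avgHess n y e x ⬝ᵥ avgHess n y e x ≤ ∑ T ∈ adjacentCells 𝒯 e, hessSq y T := by
  rw [avgHess_eq n y e x 0, dotProduct]
  simp only [← pow_two, avgHess_eq_average, hessSq]
  rw [Finset.sum_comm]
  refine Finset.sum_le_sum fun i _ => (average_sq_le he hn1 hn _).trans ?_
  exact Finset.sum_le_sum fun T _ => normalComp_sq_le hn1 i _

theorem hessForm_self (y : 𝒯.Vh) :
    𝒯.cellIntegral (fun T x => ∑ i, frob (hess y T x i) (hess y T x i))
      = ∑ T, volume.real (convexHull ℝ (T.1 : Set Plane)) * hessSq y T := by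
  refine Finset.sum_congr rfl fun T _ => ?_
  simp only [fun x => hess_eq y T x 0]
  rw [setIntegral_const, smul_eq_mul]
  rfl

/-- Each triangle has only three edges, so that sums over edges of adjacent cell quantities are
controlled by sums over cells. -/
theorem sum_adjacentCells_le {E : Finset (Finset Plane)} (hE : ∀ e ∈ E, e.card = 2)
    {q : 𝒯.Cell → ℝ} (hq : ∀ T, 0 ≤ q T) :
    ∑ e ∈ E, ∑ T ∈ adjacentCells 𝒯 e, q T ≤ 3 * ∑ T, q T := by
  classical
  simp only [adjacentCells, Finset.sum_filter]
  rw [Finset.sum_comm, Finset.mul_sum]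
  refine Finset.sum_le_sum fun T _ => ?_
  rw [← Finset.sum_filter, Finset.sum_const, nsmul_eq_mul]
  refine mul_le_mul_of_nonneg_right ?_ (hq T)
  have hsub : E.filter (fun e => e ⊆ T.1) ⊆ Finset.powersetCard 2 T.1 := by
    intro e he
    rw [Finset.mem_filter] at he
    exact Finset.mem_powersetCard.2 ⟨he.2, hE e he.1⟩
  have := Finset.card_le_card hsub
  rw [Finset.card_powersetCard, cell_card T] at this
  exact_mod_cast this

/-- The consistency term is absorbed by the Hessian and a part of the penalty: an inverse trace
estimate for piecewise constant Hessians and Young's inequality. -/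
theorem consistency_le {h σ : ℝ} (hh : 0 < h) (hreg : 𝒯.IsRegular h σ) {ΓD : Set Plane}
    {n : Finset Plane → Plane} (hn : 𝒯.IsNormalField ΓD n) {c : ℝ} (hc : 0 < c)
    (hσc : 4 * σ ^ 4 / Real.pi ≤ c) (y : 𝒯.Vh) :
    2 * edgeIntegral (𝒯.interiorEdges ∪ 𝒯.boundaryEdges ΓD)
        (fun e x => jumpGrad n y e x ⬝ᵥ avgHess n y e x)
      ≤ 1 / 2 * ∑ T, volume.real (convexHull ℝ (T.1 : Set Plane)) * hessSq y T
        + 6 * c * edgeIntegral (𝒯.interiorEdges ∪ 𝒯.boundaryEdges ΓD)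
          (fun e x => h⁻¹ * (jumpGrad n y e x ⬝ᵥ jumpGrad n y e x)) := by
  set E := 𝒯.interiorEdges ∪ 𝒯.boundaryEdges ΓD with hE
  have hcard : ∀ e ∈ E, e.card = 2 := card_activeEdge ΓD
  have hedge : ∀ e ∈ E, 2 * ∫ x in convexHull ℝ (e : Set Plane),
      jumpGrad n y e x ⬝ᵥ avgHess n y e x ∂(Measure.hausdorffMeasure 1)
      ≤ (∑ T ∈ adjacentCells 𝒯 e,
          (6 : ℝ)⁻¹ * (volume.real (convexHull ℝ (T.1 : Set Plane)) * hessSq y T))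
        + 6 * c * ∫ x in convexHull ℝ (e : Set Plane),
          h⁻¹ * (jumpGrad n y e x ⬝ᵥ jumpGrad n y e x) ∂(Measure.hausdorffMeasure 1) := by
    intro e he
    obtain ⟨hn1, hn2⟩ := hn.1 e he
    set Q := ∑ T ∈ adjacentCells 𝒯 e, hessSq y T with hQ
    have hi1 : IntegrableOn (fun x => jumpGrad n y e x ⬝ᵥ avgHess n y e x)
        (convexHull ℝ (e : Set Plane)) (Measure.hausdorffMeasure 1) :=
      integrableOn_edge (hcard e he)
        ((continuous_jumpGrad n y e).dotProduct (continuous_avgHess n y e))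
    have hi2 : IntegrableOn (fun x => h⁻¹ * (jumpGrad n y e x ⬝ᵥ jumpGrad n y e x))
        (convexHull ℝ (e : Set Plane)) (Measure.hausdorffMeasure 1) :=
      integrableOn_edge (hcard e he) (continuous_const.mul
        ((continuous_jumpGrad n y e).dotProduct (continuous_jumpGrad n y e)))
    have hi3 : IntegrableOn (fun _ : Plane => (6 * c)⁻¹ * h * Q)
        (convexHull ℝ (e : Set Plane)) (Measure.hausdorffMeasure 1) :=
      integrableOn_const (hausdorffMeasure_edge_ne_top (hcard e he))
    -- Young's inequality with weight `h / (6 c)`: each triangle has three edges, so the Hessian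
    -- terms sum up to one half of `∫ |∇²_h y|²`.
    have hpt : ∀ x, 2 * (jumpGrad n y e x ⬝ᵥ avgHess n y e x)
        ≤ (6 * c)⁻¹ * h * Q + 6 * c * (h⁻¹ * (jumpGrad n y e x ⬝ᵥ jumpGrad n y e x)) := by
      intro x
      have h1 := avgHess_dot_self_le (hcard e he) hn1 hn2 y x
      set J := jumpGrad n y e x
      set A := avgHess n y e x
      have h2 : 0 ≤ (h • A - (6 * c) • J) ⬝ᵥ (h • A - (6 * c) • J) :=
        Finset.sum_nonneg fun i _ => mul_self_nonneg _
      have h3 : (h • A - (6 * c) • J) ⬝ᵥ (h • A - (6 * c) • J)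
          = h ^ 2 * (A ⬝ᵥ A) - 2 * (6 * c) * h * (J ⬝ᵥ A) + (6 * c) ^ 2 * (J ⬝ᵥ J) := by
        simp only [sub_dotProduct, dotProduct_sub, smul_dotProduct, dotProduct_smul, smul_eq_mul,
          dotProduct_comm A J]
        ring
      rw [h3] at h2
      have h4 : h ^ 2 * (A ⬝ᵥ A) ≤ h ^ 2 * Q := by gcongr
      have h5 : 0 < (6 * c) * h := by positivity
      rw [← mul_le_mul_iff_right₀ h5]
      have h6 : 6 * c * h * ((6 * c)⁻¹ * h * Q + 6 * c * (h⁻¹ * (J ⬝ᵥ J)))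
          = h ^ 2 * Q + (6 * c) ^ 2 * (J ⬝ᵥ J) := by
        field_simp
      rw [h6]
      linarith
    have hint := setIntegral_mono (s := convexHull ℝ (e : Set Plane)) (hi1.const_mul 2)
      (hi3.add (hi2.const_mul (6 * c))) hpt
    rw [integral_const_mul] at hint
    refine hint.trans ?_
    simp only [Pi.add_apply]
    rw [integral_add hi3 (hi2.const_mul (6 * c)), setIntegral_const, smul_eq_mul]
    refine add_le_add ?_ (integral_const_mul _ _).le
    rw [hQ, Finset.mul_sum, Finset.mul_sum]
    refine Finset.sum_le_sum fun T hT => ?_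
    simp only [adjacentCells, Finset.mem_filter] at hT
    have h1 := measureReal_edge_le hreg (hcard e he) hT.2
    have h2 := sq_le_volume_cell hh hreg T
    have h3 := volume_cell_pos T
    have h4 : h ^ 2 ≤ c * volume.real (convexHull ℝ (T.1 : Set Plane)) :=
      h2.trans (by gcongr)
    have h5 := hessSq_nonneg y T
    calc (Measure.hausdorffMeasure 1).real (convexHull ℝ (e : Set Plane))
          * ((6 * c)⁻¹ * h * hessSq y T)
        ≤ h * ((6 * c)⁻¹ * h * hessSq y T) := by gcongr
      _ = h ^ 2 * ((6 * c)⁻¹ * hessSq y T) := by ring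
      _ ≤ c * volume.real (convexHull ℝ (T.1 : Set Plane)) * ((6 * c)⁻¹ * hessSq y T) := by
        gcongr
      _ = 6⁻¹ * (volume.real (convexHull ℝ (T.1 : Set Plane)) * hessSq y T) := by
        field_simp
  simp only [edgeIntegral]
  rw [Finset.mul_sum]
  refine (Finset.sum_le_sum hedge).trans ?_
  rw [Finset.sum_add_distrib, ← Finset.mul_sum E _ (6 * c)]
  refine add_le_add_left ?_ _
  refine (sum_adjacentCells_le hcard fun T => ?_).trans (le_of_eq ?_)
  · have := hessSq_nonneg y T
    have := volume_cell_pos T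
    positivity
  · rw [← Finset.mul_sum]
    ring

theorem traceMinus_eq {A : Type*} [AddCommMonoid A] {n : Finset Plane → Plane} {e : Finset Plane}
    (he : e.card = 2) (hn0 : n e ≠ 0) (hn : ∀ a ∈ e, ∀ b ∈ e, inner ℝ (n e) (b - a) = 0)
    {T : 𝒯.Cell} (heT : e ⊆ T.1) (hT : inner ℝ (n e) (bary T.1 - bary e) < 0) (q : 𝒯.Cell → A) :
    𝒯.traceMinus n e q = q T := by
  classical
  rw [traceMinus]
  refine Finset.sum_eq_single_of_mem T (by simp [heT, hT]) fun B hB hne => ?_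
  rw [Finset.mem_filter] at hB
  exact absurd (cell_eq_of_same_side he hn0 hn hB.2.1 heT (mul_pos_of_neg_of_neg hB.2.2 hT)) hne

theorem tracePlus_eq {A : Type*} [AddCommMonoid A] {n : Finset Plane → Plane} {e : Finset Plane}
    (he : e.card = 2) (hn0 : n e ≠ 0) (hn : ∀ a ∈ e, ∀ b ∈ e, inner ℝ (n e) (b - a) = 0)
    {T : 𝒯.Cell} (heT : e ⊆ T.1) (hT : 0 < inner ℝ (n e) (bary T.1 - bary e)) (q : 𝒯.Cell → A) :
    𝒯.tracePlus n e q = q T := by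
  classical
  rw [tracePlus]
  refine Finset.sum_eq_single_of_mem T (by simp [heT, hT]) fun B hB hne => ?_
  rw [Finset.mem_filter] at hB
  exact absurd (cell_eq_of_same_side he hn0 hn hB.2.1 heT (mul_pos hB.2.2 hT)) hne

/-- The jump across an edge between two cells is their difference up to sign. -/
theorem jump_eq_or {A : Type*} [AddCommGroup A] {n : Finset Plane → Plane} {e : Finset Plane}
    (he : e.card = 2) (hn0 : n e ≠ 0) (hn : ∀ a ∈ e, ∀ b ∈ e, inner ℝ (n e) (b - a) = 0)
    {T T' : 𝒯.Cell} (hne : T ≠ T') (heT : e ⊆ T.1) (heT' : e ⊆ T'.1) :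
    (∀ q : 𝒯.Cell → A, 𝒯.jump n e q = q T - q T') ∨
      ∀ q : 𝒯.Cell → A, 𝒯.jump n e q = q T' - q T := by
  have hopp : ¬ 0 < inner ℝ (n e) (bary T.1 - bary e) * inner ℝ (n e) (bary T'.1 - bary e) :=
    fun h => hne (cell_eq_of_same_side he hn0 hn heT heT' h)
  rcases lt_or_gt_of_ne (side_ne_zero he hn0 hn heT) with h1 | h1 <;>
  rcases lt_or_gt_of_ne (side_ne_zero he hn0 hn heT') with h2 | h2
  · exact absurd (mul_pos_of_neg_of_neg h1 h2) hopp
  · exact Or.inl fun q => by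
      rw [jump, traceMinus_eq he hn0 hn heT h1, tracePlus_eq he hn0 hn heT' h2]
  · exact Or.inr fun q => by
      rw [jump, traceMinus_eq he hn0 hn heT' h2, tracePlus_eq he hn0 hn heT h1]
  · exact absurd (mul_pos h1 h2) hopp

/-- The jump on a boundary edge with outward normal is the trace. -/
theorem jump_boundary {A : Type*} [AddCommGroup A] {ΓD : Set Plane} {n : Finset Plane → Plane}
    (hnf : 𝒯.IsNormalField ΓD n) {e : Finset Plane} (heb : e ∈ 𝒯.boundaryEdges ΓD)
    {T : 𝒯.Cell} (heT : e ⊆ T.1) (q : 𝒯.Cell → A) : 𝒯.jump n e q = q T := by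
  classical
  obtain ⟨hn1, hn⟩ := hnf.1 e (Finset.mem_union_right _ heb)
  have hn0 : n e ≠ 0 := fun h => by simp [h] at hn1
  have h0 : 𝒯.tracePlus n e q = 0 := by
    rw [tracePlus]
    refine Finset.sum_eq_zero fun B hB => ?_
    rw [Finset.mem_filter] at hB
    exact absurd (hnf.2 e heb B.1 B.2 hB.2.1) (not_lt.2 hB.2.2.le)
  rw [jump, traceMinus_eq (card_boundaryEdge ΓD e heb) hn0 hn heT (hnf.2 e heb T.1 T.2 heT), h0,
    sub_zero]

/-- A piecewise affine function whose value and normal derivative vanish on an edge of a triangle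
vanishes on the triangle. -/
theorem cell_eq_zero_of_edge {y : 𝒯.Vh} {T : 𝒯.Cell} (hH : ∀ x, hess y T x = 0)
    {e : Finset Plane} (he : e.card = 2) {ν : Plane} (hν : ‖ν‖ = 1)
    (hn : ∀ a ∈ e, ∀ b ∈ e, inner ℝ ν (b - a) = 0)
    (hval : ∀ x ∈ e, val y T x = 0) (hgrad : ∀ x ∈ e, grad y T x *ᵥ ν.ofLp = 0) : y T = 0 := by
  obtain ⟨p, q, hpq, rfl⟩ := Finset.card_eq_two.1 he
  have hp := hval p (by simp)
  have hq := hval q (by simp)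
  rw [val_eq_of_hess_eq_zero q p (hH p), hp, zero_add] at hq
  have hg := hgrad p (by simp)
  have horth := hn p (by simp) q (by simp)
  have hG : grad y T p = 0 := by
    rw [PiLp.inner_apply, Fin.sum_univ_two] at horth
    simp only [PiLp.sub_apply, RCLike.inner_apply, conj_trivial] at horth
    have hν2 : ν 0 ^ 2 + ν 1 ^ 2 = 1 := by
      have := EuclideanSpace.real_norm_sq_eq ν
      rw [hν, Fin.sum_univ_two] at this
      linarith
    -- A row of the gradient is orthogonal to the normal and to the edge direction `(a, b)`.
    set a := q 0 - p 0
    set b := q 1 - p 1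
    have hdet : ν 0 * b - ν 1 * a ≠ 0 := by
      intro h0
      have ha : a = 0 := by linear_combination ν 0 * horth - ν 1 * h0 - a * hν2
      have hb : b = 0 := by linear_combination ν 1 * horth + ν 0 * h0 - b * hν2
      refine hpq ?_
      ext k
      fin_cases k
      · exact (sub_eq_zero.1 ha).symm
      · exact (sub_eq_zero.1 hb).symm
    ext i j
    have e1 := congrFun hg i
    have e2 := congrFun hq i
    simp only [Matrix.mulVec, dotProduct, Fin.sum_univ_two, WithLp.ofLp_sub, Pi.sub_apply,
      Pi.zero_apply] at e1 e2
    change grad y T p i 0 * a + grad y T p i 1 * b = 0 at e2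
    fin_cases j
    · exact (mul_eq_zero.1 (show grad y T p i 0 * (ν 0 * b - ν 1 * a) = 0 by
        linear_combination b * e1 - ν 1 * e2)).resolve_right hdet
    · exact (mul_eq_zero.1 (show grad y T p i 1 * (ν 0 * b - ν 1 * a) = 0 by
        linear_combination ν 0 * e2 - a * e1)).resolve_right hdet
  refine eq_zero_of_val_eq_zero fun x => ?_
  rw [val_eq_of_hess_eq_zero x p (hH p), hp, hG, Matrix.zero_mulVec, add_zero]

/-- The interior penalty form is positive definite once the penalty parameter `η₁` exceeds a
threshold which depends on the shape regularity only. -/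
theorem ah_self_pos (hΩ : IsOpen Ω) (hΩc : IsConnected Ω) (hΩr : interior (closure Ω) = Ω)
    {ΓD : Set Plane} {h σ : ℝ} (hh : 0 < h) (hreg : 𝒯.IsRegular h σ)
    (hb : (𝒯.boundaryEdges ΓD).Nonempty) {n : Finset Plane → Plane} (hn : 𝒯.IsNormalField ΓD n)
    {η₀ η₁ : ℝ} (hη₀ : 0 < η₀) (hη₁ : 6 * (4 * σ ^ 4 / Real.pi + 1) + 1 ≤ η₁) {y : 𝒯.Vh}
    (hy : y ≠ 0) : 0 < ah ΓD n h η₀ η₁ y y := by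
  have hc : 0 < 4 * σ ^ 4 / Real.pi + 1 := by
    have : 0 ≤ σ ^ 4 := by positivity
    positivity
  have hcons := consistency_le hh hreg hn hc (by linarith) y
  set E := 𝒯.interiorEdges ∪ 𝒯.boundaryEdges ΓD with hE
  set S := ∑ T : 𝒯.Cell, volume.real (convexHull ℝ (T.1 : Set Plane)) * hessSq y T with hS
  have hterm : ∀ T : 𝒯.Cell, 0 ≤ volume.real (convexHull ℝ (T.1 : Set Plane)) * hessSq y T :=
    fun T => mul_nonneg (volume_cell_pos T).le (hessSq_nonneg y T)
  have hS0 : 0 ≤ S := Finset.sum_nonneg fun T _ => hterm T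
  have hdot : ∀ v : Fin 3 → ℝ, 0 ≤ v ⬝ᵥ v := fun v =>
    Finset.sum_nonneg fun i _ => mul_self_nonneg _
  have hJpt : ∀ e x, 0 ≤ h⁻¹ * (jumpGrad n y e x ⬝ᵥ jumpGrad n y e x) := fun e x =>
    mul_nonneg (by positivity) (hdot _)
  have hVpt : ∀ e x, 0 ≤ (h ^ 3)⁻¹ * (jumpVal n y e x ⬝ᵥ jumpVal n y e x) := fun e x =>
    mul_nonneg (by positivity) (hdot _)
  have hJe : ∀ e ∈ E, 0 ≤ ∫ x in convexHull ℝ (e : Set Plane),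
      h⁻¹ * (jumpGrad n y e x ⬝ᵥ jumpGrad n y e x) ∂(Measure.hausdorffMeasure 1) :=
    fun e _ => integral_nonneg fun x => hJpt e x
  have hVe : ∀ e ∈ E, 0 ≤ ∫ x in convexHull ℝ (e : Set Plane),
      (h ^ 3)⁻¹ * (jumpVal n y e x ⬝ᵥ jumpVal n y e x) ∂(Measure.hausdorffMeasure 1) :=
    fun e _ => integral_nonneg fun x => hVpt e x
  have hJ0 : 0 ≤ edgeIntegral E
      (fun e x => h⁻¹ * (jumpGrad n y e x ⬝ᵥ jumpGrad n y e x)) := Finset.sum_nonneg hJe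
  have hV0 : 0 ≤ edgeIntegral E
      (fun e x => (h ^ 3)⁻¹ * (jumpVal n y e x ⬝ᵥ jumpVal n y e x)) := Finset.sum_nonneg hVe
  -- If the form is not positive at `y`, then all of its nonnegative contributions vanish.
  by_contra! hneg
  rw [ah, hessForm_self, ← hE, ← hS] at hneg
  set J := edgeIntegral E (fun e x => h⁻¹ * (jumpGrad n y e x ⬝ᵥ jumpGrad n y e x)) with hJ
  set V := edgeIntegral E (fun e x => (h ^ 3)⁻¹ * (jumpVal n y e x ⬝ᵥ jumpVal n y e x)) with hV
  have hηJ : (6 * (4 * σ ^ 4 / Real.pi + 1) + 1) * J ≤ η₁ * J :=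
    mul_le_mul_of_nonneg_right hη₁ hJ0
  have hηV : 0 ≤ η₀ * V := mul_nonneg hη₀.le hV0
  have hSz : S = 0 := by linarith
  have hJz : J = 0 := by linarith
  have hVz : V = 0 := by
    have : η₀ * V = 0 := by linarith
    exact (mul_eq_zero.1 this).resolve_left hη₀.ne'
  have hH : ∀ T x, hess y T x = 0 := by
    intro T
    have h1 := (Finset.sum_eq_zero_iff_of_nonneg fun T _ => hterm T).1 hSz T (Finset.mem_univ T)
    exact hess_eq_zero_of_hessSq ((mul_eq_zero.1 h1).resolve_left (volume_cell_pos T).ne')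
  have hcard : ∀ e ∈ E, e.card = 2 := card_activeEdge ΓD
  have hjg : ∀ e ∈ E, ∀ x ∈ e, jumpGrad n y e x = 0 := by
    intro e he x hx
    have h1 := (Finset.sum_eq_zero_iff_of_nonneg hJe).1 hJz e he
    have h2 := eq_zero_of_edge_integral_eq_zero (hcard e he) (continuous_const.mul
      ((continuous_jumpGrad n y e).dotProduct (continuous_jumpGrad n y e))) (hJpt e) h1
      (subset_convexHull ℝ _ hx)
    exact dotProduct_self_eq_zero.1 ((mul_eq_zero.1 h2).resolve_left (by positivity))
  have hjv : ∀ e ∈ E, ∀ x ∈ e, jumpVal n y e x = 0 := by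
    intro e he x hx
    have h1 := (Finset.sum_eq_zero_iff_of_nonneg hVe).1 hVz e he
    have h2 := eq_zero_of_edge_integral_eq_zero (hcard e he) (continuous_const.mul
      ((continuous_jumpVal n y e).dotProduct (continuous_jumpVal n y e))) (hVpt e) h1
      (subset_convexHull ℝ _ hx)
    exact dotProduct_self_eq_zero.1 ((mul_eq_zero.1 h2).resolve_left (by positivity))
  refine hy (funext ?_)
  obtain ⟨e₀, he₀⟩ := hb
  have he₀E : e₀ ∈ E := Finset.mem_union_right _ he₀
  have he₀f : e₀ ∈ 𝒯.complex.faces := by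
    simp only [boundaryEdges, Finset.mem_filter] at he₀
    exact (mem_edges.1 he₀.1).1
  obtain ⟨t₀, ht₀, hsub, ht₀c⟩ := 𝒯.pure e₀ he₀f
  set T₀ : 𝒯.Cell := ⟨t₀, mem_cells.2 ⟨ht₀, ht₀c⟩⟩ with hT₀
  refine cell_induction hΩ hΩc hΩr (P := fun T => y T = 0) (T₀ := T₀) ?_ ?_
  · obtain ⟨hn1, hn2⟩ := hn.1 e₀ he₀E
    refine cell_eq_zero_of_edge (hH T₀) (hcard e₀ he₀E) hn1 hn2 (fun x hx => ?_) fun x hx => ?_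
    · have := hjv e₀ he₀E x hx
      rwa [jumpVal, jump_boundary hn he₀ (T := T₀) hsub] at this
    · have := hjg e₀ he₀E x hx
      rwa [jumpGrad, jump_boundary hn he₀ (T := T₀) hsub] at this
  · intro T T' e he heT heT' hne hyT
    have heE : e ∈ E := Finset.mem_union_left _ he
    obtain ⟨hn1, hn2⟩ := hn.1 e heE
    have hn0 : n e ≠ 0 := fun h => by simp [h] at hn1
    have hvT : ∀ x, val y T x = 0 := fun x => by funext i; simp [val, hyT]
    have hgT : ∀ x, grad y T x = 0 := fun x => by ext i j; simp [grad, hyT]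
    refine cell_eq_zero_of_edge (hH T') (hcard e heE) hn1 hn2 (fun x hx => ?_) fun x hx => ?_
    · have := hjv e heE x hx
      rw [jumpVal] at this
      rcases jump_eq_or (A := Fin 3 → ℝ) (hcard e heE) hn0 hn2 hne heT heT' with h | h <;>
        simpa [h, hvT] using this
    · have := hjg e heE x hx
      rw [jumpGrad] at this
      rcases jump_eq_or (A := Matrix (Fin 3) (Fin 2) ℝ) (hcard e heE) hn0 hn2 hne heT heT'
        with h | h <;> simpa [h, hgT, Matrix.neg_mulVec] using this

end Positivity

/-! ### The proximal system in terms of gradients at barycenters -/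

section Reduction

open MeasureTheory

variable {Ω : Set Plane} {𝒯 : Triangulation Ω}

instance finiteDimensional_restrictTotalDegree :
    FiniteDimensional ℝ (MvPolynomial.restrictTotalDegree (Fin 2) ℝ 2) := by
  classical
  let s : Finset (MvPolynomial (Fin 2) ℝ) :=
    {1, .X 0, .X 1, .X 0 * .X 0, .X 0 * .X 1, .X 1 * .X 1}
  refine Submodule.finiteDimensional_of_le (S₂ := Submodule.span ℝ (s : Set _)) fun p hp => ?_
  obtain ⟨a, b₀, b₁, c₀, c₁, c₂, rfl⟩ := exists_quadratic_coeffs hp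
  have hs : ∀ q ∈ s, ∀ r : ℝ, .C r * q ∈ Submodule.span ℝ (s : Set (MvPolynomial (Fin 2) ℝ)) := by
    intro q hq r
    rw [← MvPolynomial.smul_eq_C_mul]
    exact Submodule.smul_mem _ _ (Submodule.subset_span hq)
  have h1 := hs 1 (by simp [s]) a
  rw [mul_one] at h1
  exact add_mem (add_mem (add_mem (add_mem (add_mem h1 (hs _ (by simp [s]) _))
    (hs _ (by simp [s]) _)) (hs _ (by simp [s]) _)) (hs _ (by simp [s]) _)) (hs _ (by simp [s]) _)

/-- The broken gradient is affine on each triangle, so pairings with constants only see its value at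
the barycenter. -/
theorem setIntegral_frob_grad (m : Matrix (Fin 3) (Fin 2) ℝ) (w : 𝒯.Vh) (T : 𝒯.Cell) :
    ∫ x in convexHull ℝ (T.1 : Set Plane), frob m (grad w T x)
      = volume.real (convexHull ℝ (T.1 : Set Plane)) * frob m (gradBary 𝒯 w T) := by
  let φ : Plane →ᵃ[ℝ] ℝ :=
    (∑ k : Fin 2, (∑ i, ∑ j, m i j * hess w T 0 i j k) •
      (EuclideanSpace.proj k : Plane →L[ℝ] ℝ).toLinearMap).toAffineMap
    + AffineMap.const ℝ Plane (frob m (grad w T 0))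
  have hφ : ∀ x, frob m (grad w T x) = φ x := by
    intro x
    have e : φ x = (∑ k : Fin 2, (∑ i, ∑ j, m i j * hess w T 0 i j k) * x k)
        + frob m (grad w T 0) := by
      simp [φ]
    rw [e]
    simp only [frob, fun i j => grad_eq_add_hess w T x 0 i j, Fin.sum_univ_two, Fin.sum_univ_three,
      PiLp.zero_apply, sub_zero]
    ring
  simp only [hφ]
  rw [setIntegral_affine (cell_card T) (cell_indep T), ← hφ]
  rfl

theorem matInner_const_grad (m : 𝒯.Mh) (w : 𝒯.Vh) :
    𝒯.matInner (fun T _ => m T) (grad w)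
      = ∑ T : 𝒯.Cell, volume.real (convexHull ℝ (T.1 : Set Plane))
        * frob (m T) (gradBary 𝒯 w T) :=
  Finset.sum_congr rfl fun T _ => setIntegral_frob_grad (m T) w T

theorem matInner_grad_const (m : 𝒯.Mh) (w : 𝒯.Vh) :
    𝒯.matInner (grad w) (fun T _ => m T)
      = ∑ T : 𝒯.Cell, volume.real (convexHull ℝ (T.1 : Set Plane))
        * frob (m T) (gradBary 𝒯 w T) := by
  rw [← matInner_const_grad]
  simp only [matInner, fun T x => frob_comm (grad w T x)]

theorem matInner_const (m m' : 𝒯.Mh) :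
    𝒯.matInner (fun T _ => m T) (fun T _ => m' T)
      = ∑ T : 𝒯.Cell, volume.real (convexHull ℝ (T.1 : Set Plane)) * frob (m T) (m' T) := by
  refine Finset.sum_congr rfl fun T _ => ?_
  rw [setIntegral_const, smul_eq_mul]

theorem lh_eq (G m : 𝒯.Cell → Plane → Matrix (Fin 3) (Fin 2) ℝ) (γ : 𝒯.Upsh) :
    𝒯.lh G m γ = ∑ T : 𝒯.Cell, volume.real (convexHull ℝ (T.1 : Set Plane))
      * frob (γ T).1 ((G T (bary T.1))ᵀ * m T (bary T.1) + (m T (bary T.1))ᵀ * G T (bary T.1)) := by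
  refine Finset.sum_congr rfl fun T _ => ?_
  rw [setIntegral_const, smul_eq_mul]

theorem eq_zero_of_frob_self {m n : Type*} [Fintype m] [Fintype n] {A : Matrix m n ℝ}
    (h : frob A A = 0) : A = 0 := by
  ext i j
  have h1 := (Finset.sum_eq_zero_iff_of_nonneg fun i _ =>
    Finset.sum_nonneg fun j _ => mul_self_nonneg _).1 h i (Finset.mem_univ i)
  exact mul_self_eq_zero.1 ((Finset.sum_eq_zero_iff_of_nonneg fun j _ => mul_self_nonneg _).1 h1 j
    (Finset.mem_univ j))

theorem frob_self_nonneg {m n : Type*} [Fintype m] [Fintype n] (A : Matrix m n ℝ) :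
    0 ≤ frob A A :=
  Finset.sum_nonneg fun _ _ => Finset.sum_nonneg fun _ _ => mul_self_nonneg _

theorem eq_zero_of_sum_frob_self {m n : Type*} [Fintype m] [Fintype n]
    {A : 𝒯.Cell → Matrix m n ℝ}
    (h : ∑ T : 𝒯.Cell, volume.real (convexHull ℝ (T.1 : Set Plane)) * frob (A T) (A T) = 0)
    (T : 𝒯.Cell) : A T = 0 :=
  eq_zero_of_frob_self ((mul_eq_zero.1 ((Finset.sum_eq_zero_iff_of_nonneg fun T _ =>
    mul_nonneg (volume_cell_pos T).le (frob_self_nonneg (A T))).1 h T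
      (Finset.mem_univ T))).resolve_left (volume_cell_pos T).ne')

variable {ΓD : Set Plane} {n : Finset Plane → Plane} {h η₀ η₁ τ : ℝ} {f yD GD : Plane → Fin 3 → ℝ}
  {y y' : 𝒯.Vh} {μ : 𝒯.Mh} {γ : 𝒯.Upsh}

theorem gradBary_update (hs : IsProximalStep ΓD n h η₀ η₁ f yD GD τ y y' μ γ) (T : 𝒯.Cell) :
    gradBary 𝒯 y' T = stiefelExp (gradBary 𝒯 y T) (τ • μ T) := by
  let A : 𝒯.Mh := fun T => gradBary 𝒯 y' T - stiefelExp (gradBary 𝒯 y T) (τ • μ T)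
  have h1 := hs.update A
  have h2 := matInner_const (fun T => stiefelExp (gradBary 𝒯 y T) (τ • μ T)) A
  rw [matInner_grad_const] at h1
  change _ - matInner (fun T _ => stiefelExp (gradBary 𝒯 y T) (τ • μ T)) _ = 0 at h1
  rw [h2, ← Finset.sum_sub_distrib] at h1
  refine sub_eq_zero.1 (eq_zero_of_sum_frob_self (A := A) ?_ T)
  rw [← h1]
  refine Finset.sum_congr rfl fun T _ => ?_
  rw [frob_comm (A T) (gradBary 𝒯 y' T), ← mul_sub]
  congr 1
  simp only [A, frob, ← Finset.sum_sub_distrib, ← sub_mul]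
  rfl

theorem tangent_at_bary (hs : IsProximalStep ΓD n h η₀ η₁ f yD GD τ y y' μ γ) (T : 𝒯.Cell) :
    (gradBary 𝒯 y T)ᵀ * μ T + (μ T)ᵀ * gradBary 𝒯 y T = 0 := by
  let ζ : 𝒯.Upsh := fun T => ⟨(gradBary 𝒯 y T)ᵀ * μ T + (μ T)ᵀ * gradBary 𝒯 y T, by
    simp [Matrix.transpose_add, Matrix.transpose_mul, add_comm]⟩
  have h1 := hs.tangent ζ
  rw [lh_eq] at h1
  exact eq_zero_of_sum_frob_self (A := fun T => (ζ T).1) h1 T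

end Reduction

end

end PlateIPDG


theorem mainTheorem2 (σ : ℝ) :
    ∃ ηmin : ℝ, 0 < ηmin ∧
      ∀ (Ω : Set PlateIPDG.Plane), IsOpen Ω → IsConnected Ω → interior (closure Ω) = Ω →
      ∀ (ΓD : Set PlateIPDG.Plane),
        (∃ O : Set PlateIPDG.Plane, IsOpen O ∧ ΓD = frontier Ω ∩ O) →
      ∀ (𝒯 : PlateIPDG.Triangulation Ω) (h : ℝ), 0 < h → 𝒯.IsRegular h σ →
        (𝒯.boundaryEdges ΓD).Nonempty →
      ∀ (n : Finset PlateIPDG.Plane → PlateIPDG.Plane), 𝒯.IsNormalField ΓD n →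
      ∀ (η₀ η₁ : ℝ), 0 < η₀ → ηmin ≤ η₁ →
      ∀ (f yD GD : PlateIPDG.Plane → Fin 3 → ℝ),
        MeasureTheory.MemLp f 2 (MeasureTheory.volume.restrict Ω) →
        MeasureTheory.MemLp yD 2
          ((MeasureTheory.Measure.hausdorffMeasure 1).restrict ΓD) →
        MeasureTheory.MemLp GD 2
          ((MeasureTheory.Measure.hausdorffMeasure 1).restrict ΓD) →
      ∃ τ₀ : ℝ, 0 < τ₀ ∧ ∀ τ : ℝ, 0 < τ → τ < τ₀ →
        ∀ y ∈ 𝒯.admissible, ∀ (y' : 𝒯.Vh) (μ : 𝒯.Mh) (γ : 𝒯.Upsh),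
          PlateIPDG.Triangulation.IsProximalStep ΓD n h η₀ η₁ f yD GD τ y y' μ γ →
          y' ≠ y →
          PlateIPDG.Triangulation.Eh ΓD n h η₀ η₁ f yD GD y'
            < PlateIPDG.Triangulation.Eh ΓD n h η₀ η₁ f yD GD y := by
  open PlateIPDG PlateIPDG.Triangulation in
  have hσ : 0 ≤ 4 * σ ^ 4 / Real.pi := by positivity
  refine ⟨6 * (4 * σ ^ 4 / Real.pi + 1) + 1, by positivity, ?_⟩
  intro Ω hΩ hΩc hΩr ΓD _ 𝒯 h hh hreg hb n hn η₀ η₁ hη₀ hη₁ f yD GD hf hyD hGD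
  obtain ⟨Λ, hΛ⟩ := exists_dataForm (𝒯 := 𝒯) hΩr ΓD n h η₀ η₁ hf hyD hGD
  have hpos : ∀ y : 𝒯.Vh, y ≠ 0 → 0 < ah ΓD n h η₀ η₁ y y := fun y hy =>
    ah_self_pos hΩ hΩc hΩr hh hreg hb hn hη₀ hη₁ hy
  let core : InnerProductSpace.Core ℝ 𝒯.Vh :=
    { inner := fun y w => ahForm 𝒯 ΓD n h η₀ η₁ y w
      conj_inner_symm := fun y w => by
        simp only [conj_trivial, ahForm_apply]
        exact ah_comm ΓD n h η₀ η₁ w y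
      re_inner_nonneg := fun y => by
        by_cases hy : y = 0
        · simp [hy]
        · rw [ahForm_apply]
          exact (hpos y hy).le
      add_left := fun x y z => by simp
      smul_left := fun x y r => by simp
      definite := fun y hy => by
        by_contra hne
        rw [ahForm_apply] at hy
        exact (hpos y hne).ne' hy }
  let i₁ : NormedAddCommGroup 𝒯.Vh := core.toNormedAddCommGroup
  let i₂ : InnerProductSpace ℝ 𝒯.Vh := InnerProductSpace.ofCore core.toCore
  have hinner : ∀ y w : 𝒯.Vh, inner ℝ y w = ah ΓD n h η₀ η₁ y w := fun y w =>
    ahForm_apply ΓD n h η₀ η₁ y w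
  obtain ⟨τ₀, hτ₀, hmain⟩ := exists_step_energy_lt (V := 𝒯.Vh)
    (fun T : 𝒯.Cell => MeasureTheory.volume.real (convexHull ℝ (T.1 : Set Plane)))
    volume_cell_pos (gradBary 𝒯) Λ (liftGrad 𝒯) gradBary_liftGrad
  refine ⟨τ₀, hτ₀, fun τ hτ hττ₀ y hy y' μ γ hs hne => ?_⟩
  have hstep : IsAbstractStep
      (fun T : 𝒯.Cell => MeasureTheory.volume.real (convexHull ℝ (T.1 : Set Plane)))
      (gradBary 𝒯) Λ τ y y' μ (fun T => (γ T).1) :=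
    { mem := hy
      mem' := hs.mem_admissible
      symm := fun T => (γ T).2
      momentum := fun w => by
        have h1 := hs.momentum w
        rw [matInner_const_grad, lh_eq] at h1
        rw [hinner, hΛ, ← h1]
        rfl
      update := gradBary_update hs
      tangent := tangent_at_bary hs }
  have h1 := hmain τ hτ hττ₀ y y' μ _ hstep hne
  rw [hinner, hinner, hΛ, hΛ] at h1
  simp only [Eh]
  linarith
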